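/- Let $G$ be a connected finite graph with edge set $E$; loops and multiple edges are allowed. Conventions: - A cycle is the edge set $C=\{v_iv_{i+1}: 1\le i\le n\}$ of a closed walk on distinct vertices $v_1,\dots,v_n$ ($n\ge 1$, $v_{n+1}=v_1$, the $n$ edges distinct; a loop is a cycle). A cocycle is an inclusion-minimal nonempty cut, a cut being the set of all edges between some vertex set $W$ and its complement. A directed cycle is a cycle with all its edges directed from $v_i$ to $v_{i+1}$, or all from $v_{i+1}$ to $v_i$. A directed cocycle is a cocycle with all its edges directed from $W$ to its complement, or all the other way. We denote a directed cycle by $\vec C$ and its underlying edge set by $C$, and similarly for cocycles. - An orientation $O$ of $G$ assigns one of two directions to every edge (a loop also has two directions). A directed cycle or cocycle is in $O$ if all of its arcs are arcs of $O$. A spanning subgraph is identified with its edge set, a subset of $E$. A spanning forest is a spanning subgraph containing no cycle, and a spanning tree is a connected spanning forest. - Fix a reference orientation and so view directed cycles and cocycles as $\{0,\pm1\}$-vectors in $\mathbb R^E$. A cycle signature $\sigma$ chooses for each cycle $C$ one of its two directed cycles $\sigma(C)$. It is acyclic if $\sum_C a_C\sigma(C)=0$ with all $a_C\ge 0$ real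 implies that all $a_C=0$. An orientation is $\sigma$-compatible if every directed cycle in it is chosen by $\sigma$. Acyclic cocycle signatures $\sigma^*$ and $\sigma^*$-compatibility are defined in the same way with cocycles. $(\sigma,\sigma^*)$-compatible means both. - For a spanning tree $T$, let $C(T,e)$ be the unique cycle in $T\cup\{e\}$ if $e\notin T$, and let $C^*(T,e)$ be the unique cocycle in $(E\setminus T)\cup\{e\}$ if $e\in T$. Let $g_{\sigma,\sigma^*}(T)$ be the orientation in which each $e\notin T$ is directed as in $\sigma(C(T,e))$ and each $e\in T$ is directed as in $\sigma^*(C^*(T,e))$. **Theorem.** Fix an acyclic cycle signature $\sigma$ and an acyclic cocycle signature $\sigma^*$ of $G$. The map $g_{\sigma,\sigma^*}$ is a bijection from the spanning trees to the $(\sigma,\sigma^*)$-compatible orientations. For every orientation $O$ there is a unique $(\sigma,\sigma^*)$-compatible orientation $O^{cp}$ such that $O$ is obtained from $O^{cp}$ by reversing some pairwise disjoint directed cycles $\{\vec C_i\}_{i\in I}$ and directed cocycles $\{\vec C^*_j\}_{j\in J}$ in $O^{cp}$. The set $$\varphi_{\sigma,\sigma^*}(O)=\Bigl(g_{\sigma,\sigma^*}^{-1}(O^{cp})\cup\bigcup_{i\in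 I}C_i\Bigr)\setminus\bigcup_{j\in J}C^*_j$$ does not depend on the choice of these families. Moreover: (1) $\varphi_{\sigma,\sigma^*}$ is a bijection from the orientations of $G$ to the spanning subgraphs of $G$. (2) $\varphi_{\sigma,\sigma^*}$ restricts to a bijection from the $\sigma$-compatible orientations to the spanning forests of $G$, and $\varphi_{\sigma,\sigma^*}(O)=g_{\sigma,\sigma^*}^{-1}(O^{cp})\setminus\bigcup_{j}C^*_j$ for every $\sigma$-compatible $O$. (3) $\varphi_{\sigma,\sigma^*}$ restricts to a bijection from the $\sigma^*$-compatible orientations to the connected spanning subgraphs of $G$, and $\varphi_{\sigma,\sigma^*}(O)=g_{\sigma,\sigma^*}^{-1}(O^{cp})\cup\bigcup_{i}C_i$ for every $\sigma^*$-compatible $O$. -/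

import Mathlib

open scoped Graph

namespace Graph

variable {α β : Type*}

/-! ### Spanning subgraphs, cycles and cocycles of a multigraph

A spanning subgraph of `G` keeps all vertices of `G`, so it is given by its edge set
`S : Set E(G)`. Loops and multiple edges are allowed. -/

/-- The spanning subgraph of `G` with edge set `S` is connected (and has a vertex). -/
def IsConnectedSpanning (G : Graph α β) (S : Set E(G)) : Prop :=
  V(G).Nonempty ∧
    ∀ u v : V(G), Relation.ReflTransGen (fun x y : V(G) => ∃ e ∈ S, G.IsLink e x y) u v

/-- The graph `G` is connected. -/
def IsConnectedGraph (G : Graph α β) : Prop :=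
  G.IsConnectedSpanning Set.univ

/-- A set `C` of edges is a cycle: there are distinct vertices `v 0, …, v n` (`n + 1 ≥ 1` of them)
and distinct edges `e i` joining `v i` to `v (i + 1)`, indices being read cyclically, such that
`C` consists of the edges `e i`. One loop is a cycle, and so are two parallel edges. -/
def IsCycle (G : Graph α β) (C : Set E(G)) : Prop :=
  ∃ (n : ℕ) (v : Fin (n + 1) → V(G)) (e : Fin (n + 1) → E(G)),
    Function.Injective v ∧ Function.Injective e ∧ Set.range e = C ∧
      ∀ i, G.IsLink (e i) (v i) (v (i + 1))

/-- The cut of a set `W` of vertices: the edges with one end in `W` and the other one outside. -/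
def cut (G : Graph α β) (W : Set V(G)) : Set E(G) :=
  {e | ∃ u v : V(G), u ∈ W ∧ v ∉ W ∧ G.IsLink e u v}

/-- A cocycle is a nonempty cut which is minimal for inclusion. -/
def IsCocycle (G : Graph α β) (D : Set E(G)) : Prop :=
  Minimal (fun X : Set E(G) => X.Nonempty ∧ ∃ W, G.cut W = X) D

/-- The spanning subgraph with edge set `S` is a forest. -/
def IsSpanningForest (G : Graph α β) (S : Set E(G)) : Prop :=
  ∀ C, G.IsCycle C → ¬ C ⊆ S

/-- The spanning subgraph with edge set `T` is a tree. -/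
def IsSpanningTree (G : Graph α β) (T : Set E(G)) : Prop :=
  G.IsConnectedSpanning T ∧ G.IsSpanningForest T

/-- `C` is the fundamental cycle of `e ∉ T` with respect to `T`: the unique cycle in `T ∪ {e}`. -/
def IsFundamentalCycle (G : Graph α β) (T : Set E(G)) (e : E(G)) (C : Set E(G)) : Prop :=
  (G.IsCycle C ∧ C ⊆ T ∪ {e}) ∧ ∀ C', G.IsCycle C' → C' ⊆ T ∪ {e} → C' = C

/-- `D` is the fundamental cocycle of `e ∈ T` with respect to `T`: the unique cocycle in
`(E ∖ T) ∪ {e}`. -/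
def IsFundamentalCocycle (G : Graph α β) (T : Set E(G)) (e : E(G)) (D : Set E(G)) : Prop :=
  (G.IsCocycle D ∧ D ⊆ Tᶜ ∪ {e}) ∧ ∀ D', G.IsCocycle D' → D' ⊆ Tᶜ ∪ {e} → D' = D

/-! ### Orientations

With respect to a fixed reference orientation, a direction of an edge is a sign: `1` for
the reference direction and `-1` for the opposite one (so a loop has two directions). -/

/-- A reference orientation of `G`: a tail and a head for every edge. -/
structure RefOrientation (G : Graph α β) where
  tail : E(G) → V(G)
  head : E(G) → V(G)
  isLink : ∀ e : E(G), G.IsLink e (tail e) (head e)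

/-- An orientation of `G`, as a sign vector with respect to the reference orientation. -/
abbrev Orientation (G : Graph α β) : Type _ := E(G) → ℤˣ

/-- A directed cycle or directed cocycle is a vector with entries in `{0, 1, -1}`. It is in the
orientation `O` if every arc of it is an arc of `O`. -/
def IsIn {G : Graph α β} (p : E(G) → ℤ) (O : G.Orientation) : Prop :=
  ∀ e, p e ≠ 0 → p e = (O e : ℤ)

namespace RefOrientation

variable {G : Graph α β}

/-- The edge `e` with sign `s` is an arc directed from `u` to `w`. -/
def IsArc (R : G.RefOrientation) (e : E(G)) (s : ℤ) (u w : V(G)) : Prop :=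
  (s = 1 ∧ R.tail e = u ∧ R.head e = w) ∨ (s = -1 ∧ R.head e = u ∧ R.tail e = w)

/-- `c` is a directed cycle: its support is a cycle, all of whose edges are directed
from `v i` to `v (i + 1)`. -/
def IsDirectedCycle (R : G.RefOrientation) (c : E(G) → ℤ) : Prop :=
  ∃ (n : ℕ) (v : Fin (n + 1) → V(G)) (e : Fin (n + 1) → E(G)),
    Function.Injective v ∧ Function.Injective e ∧ Set.range e = Function.support c ∧
      ∀ i, R.IsArc (e i) (c (e i)) (v i) (v (i + 1))

/-- `d` is a directed cocycle: its support is a cocycle, which is the cut of some `W`, and all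
of whose edges are directed from `W` to the complement of `W`. -/
def IsDirectedCocycle (R : G.RefOrientation) (d : E(G) → ℤ) : Prop :=
  G.IsCocycle (Function.support d) ∧
    ∃ W : Set V(G), Function.support d = G.cut W ∧
      ∀ e, d e ≠ 0 → ∃ u w, u ∈ W ∧ w ∉ W ∧ R.IsArc e (d e) u w

/-- A cycle signature: the choice of a direction for each cycle. -/
structure CycleSignature (R : G.RefOrientation) where
  dir : {C : Set E(G) // G.IsCycle C} → E(G) → ℤ
  isDirectedCycle : ∀ C, R.IsDirectedCycle (dir C)
  support_dir : ∀ C, Function.support (dir C) = C.1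

/-- A cocycle signature: the choice of a direction for each cocycle. -/
structure CocycleSignature (R : G.RefOrientation) where
  dir : {D : Set E(G) // G.IsCocycle D} → E(G) → ℤ
  isDirectedCocycle : ∀ D, R.IsDirectedCocycle (dir D)
  support_dir : ∀ D, Function.support (dir D) = D.1

variable {R : G.RefOrientation}

/-- The only nonnegative real combination of the chosen directed cycles which vanishes is the
trivial one. (The sum is finite if `G` has finitely many edges.) -/
def CycleSignature.Acyclic (σ : R.CycleSignature) : Prop :=
  ∀ a : {C : Set E(G) // G.IsCycle C} → ℝ, (∀ C, 0 ≤ a C) →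
    (∀ e, ∑ᶠ C, a C * (σ.dir C e : ℝ) = 0) → ∀ C, a C = 0

/-- The only nonnegative real combination of the chosen directed cocycles which vanishes is the
trivial one. (The sum is finite if `G` has finitely many edges.) -/
def CocycleSignature.Acyclic (τ : R.CocycleSignature) : Prop :=
  ∀ a : {D : Set E(G) // G.IsCocycle D} → ℝ, (∀ D, 0 ≤ a D) →
    (∀ e, ∑ᶠ D, a D * (τ.dir D e : ℝ) = 0) → ∀ D, a D = 0

/-- `O` is compatible with the cycle signature `σ`: all directed cycles in `O` are in `σ`. -/
def CycleSignature.Compatible (σ : R.CycleSignature) (O : G.Orientation) : Prop :=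
  ∀ c, R.IsDirectedCycle c → IsIn c O → ∃ C, σ.dir C = c

/-- `O` is compatible with the cocycle signature `τ`: all directed cocycles in `O` are in `τ`. -/
def CocycleSignature.Compatible (τ : R.CocycleSignature) (O : G.Orientation) : Prop :=
  ∀ d, R.IsDirectedCocycle d → IsIn d O → ∃ D, τ.dir D = d

/-- `O` is the orientation associated with `T`: every `e ∉ T` is directed as in the chosen
direction of the fundamental cycle of `e`, and every `e ∈ T` is directed as in the chosen
direction of the fundamental cocycle of `e`. -/
def IsGeometricImage (σ : R.CycleSignature) (τ : R.CocycleSignature) (T : Set E(G))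
    (O : G.Orientation) : Prop :=
  (∀ e, e ∉ T → ∃ C, G.IsFundamentalCycle T e C.1 ∧ (O e : ℤ) = σ.dir C e) ∧
    (∀ e, e ∈ T → ∃ D, G.IsFundamentalCocycle T e D.1 ∧ (O e : ℤ) = τ.dir D e)

/-- The set of edges in the members of a family of directed cycles or cocycles. -/
def edgesOf (F : Set (E(G) → ℤ)) : Set E(G) :=
  ⋃ p ∈ F, Function.support p

/-- `O` is obtained from `O'` by reversing the pairwise disjoint directed cycles in `𝒞` and
directed cocycles in `𝒟`, all of which are in `O'`. -/
structure IsReversal (R : G.RefOrientation) (O' : G.Orientation) (𝒞 𝒟 : Set (E(G) → ℤ))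
    (O : G.Orientation) : Prop where
  cycles : ∀ c ∈ 𝒞, R.IsDirectedCycle c ∧ IsIn c O'
  cocycles : ∀ d ∈ 𝒟, R.IsDirectedCocycle d ∧ IsIn d O'
  disjoint_cycles : 𝒞.PairwiseDisjoint Function.support
  disjoint_cocycles : 𝒟.PairwiseDisjoint Function.support
  disjoint_cycle_cocycle : ∀ c ∈ 𝒞, ∀ d ∈ 𝒟, Disjoint (Function.support c) (Function.support d)
  reversed : ∀ e, e ∈ edgesOf 𝒞 ∪ edgesOf 𝒟 → O e = -O' e
  unchanged : ∀ e, e ∉ edgesOf 𝒞 ∪ edgesOf 𝒟 → O e = O' e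

end RefOrientation

end Graph

/-! Everything is proved for a self-dual abstraction, `Digraphoid`, in which cycles and cocycles
play symmetric roles; each cocycle statement is the cycle statement for `Digraphoid.dual`. A flow is
a real vector orthogonal to all cocircuits. By Minty's painting property, the support of a nonzero
flow contains a circuit whose signs agree with those of the flow (`exists_conformal`), and this is
the tool behind nearly every step.

By Gordan's theorem (`exists_ip_pos`) an acyclic signature is the choice of the directions that pair
positively with some weight: `w` for cycles, `wd` for cocycles. A tree T has a primal basic solution
x in wd + flows, supported on T, and a dual one z in w + coflows, supported off T. The orientation
matched with T has the signs of x on T and of z off T (`IsGeo`). A compatible orientation is reached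
by linear programming: minimise w·x over the points of wd + flows whose signs fit the orientation
(`exists_isGeo`). Two trees matched with one orientation coincide by complementary slackness
(`IsGeo.subset`).

A union A of disjoint directed cycles of O is encoded by the restriction of O to A being a flow.
Taking A of least w-weight, and B dually, and reversing both gives the compatible orientation
(`compat_flip_of_minimal`); `eq_of_compat_flip` shows that A and B are forced.

The core is the injectivity of φ. For large N, add N times the restriction of O to A to x, and N
times its restriction to B to z. The new pair lies, edge by edge, on a staircase curve determined by
O and S = (T ∪ A) \ B (`IsGeo.isStair`). For two orientations with the same S, every product (x -
x')(z - z') is at most 0, while orthogonality makes their sum 0, so all vanish. If x ≠ x', then on a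
circuit in the support of x - x' the values of z are 0 or ±N, so its pairing with w is a multiple of
N, although it is nonzero and smaller than N in absolute value (`IsStair.x_unique`). Hence x = x',
dually z = z', and the signs give back O. Counting turns injectivity into bijectivity. Forests
correspond to A = ∅ and connected subgraphs to B = ∅. -/

/-- A family of signed circuits and cocircuits with entries in `{0, 1, -1}` which satisfies
orthogonality and Minty's painting property. -/
structure Digraphoid (E : Type*) [Fintype E] where
  circ : Set (E → ℤ)
  cocirc : Set (E → ℤ)
  circ_val : ∀ c ∈ circ, ∀ e, c e = 0 ∨ c e = 1 ∨ c e = -1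
  cocirc_val : ∀ d ∈ cocirc, ∀ e, d e = 0 ∨ d e = 1 ∨ d e = -1
  circ_ne : ∀ c ∈ circ, ∃ e, c e ≠ 0
  cocirc_ne : ∀ d ∈ cocirc, ∃ e, d e ≠ 0
  circ_neg : ∀ c ∈ circ, -c ∈ circ
  cocirc_neg : ∀ d ∈ cocirc, -d ∈ cocirc
  orth : ∀ c ∈ circ, ∀ d ∈ cocirc, ∑ e, c e * d e = 0
  -- Elements of `P` may be used positively and those of `N` negatively; an element of both is free
  -- for the circuit and barred from the cocircuit, and an element of neither is the reverse.
  painting : ∀ (P N : Set E) (e : E),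
    (∃ c ∈ circ, c e = 1 ∧ ∀ f, f ≠ e → (c f = 1 → f ∈ P) ∧ (c f = -1 → f ∈ N)) ∨
    (∃ d ∈ cocirc, d e = 1 ∧ ∀ f, f ≠ e → (d f = 1 → f ∉ N) ∧ (d f = -1 → f ∉ P))

/-! ### Flows, conformal circuits and bases -/

namespace Digraphoid

variable {E : Type*}

/-- Every arc of `c` is an arc of `o`. -/
def Conforms (c : E → ℤ) (o : E → ℤˣ) : Prop := ∀ e, c e ≠ 0 → c e = (o e : ℤ)

/-- Sign of an element in an orientation, as a real number. -/
def sg (o : E → ℤˣ) (e : E) : ℝ := ((o e : ℤ) : ℝ)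

theorem sg_eq (o : E → ℤˣ) (e : E) : sg o e = 1 ∨ sg o e = -1 := by
  rcases Int.units_eq_one_or (o e) with h | h <;> simp [sg, h]

theorem sg_mul_self (o : E → ℤˣ) (e : E) : sg o e * sg o e = 1 := by
  rcases sg_eq o e with h | h <;> simp [h]

theorem eq_of_sg_eq {o o' : E → ℤˣ} {e : E} (h : sg o e = sg o' e) : o e = o' e := by
  unfold sg at h
  exact_mod_cast h

variable [Fintype E]

/-- Circuits and cocircuits exchanged. -/
def dual (M : Digraphoid E) : Digraphoid E where
  circ := M.cocirc
  cocirc := M.circ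
  circ_val := M.cocirc_val
  cocirc_val := M.circ_val
  circ_ne := M.cocirc_ne
  cocirc_ne := M.circ_ne
  circ_neg := M.cocirc_neg
  cocirc_neg := M.circ_neg
  orth c hc d hd := by
    rw [← M.orth d hd c hc]
    exact Finset.sum_congr rfl fun e _ => mul_comm _ _
  painting P N e := by
    -- The constraints on a cocircuit are those on a circuit with the two classes complemented and
    -- exchanged.
    rcases M.painting Nᶜ Pᶜ e with ⟨c, hc, h1, h⟩ | ⟨d, hd, h1, h⟩
    · exact Or.inr ⟨c, hc, h1, fun f hf => ⟨(h f hf).1, (h f hf).2⟩⟩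
    · exact Or.inl ⟨d, hd, h1, fun f hf =>
        ⟨fun hh => not_not.1 ((h f hf).1 hh), fun hh => not_not.1 ((h f hf).2 hh)⟩⟩

/-- The pairing of an integer vector with a real one. -/
def ip (c : E → ℤ) (x : E → ℝ) : ℝ := ∑ e, (c e : ℝ) * x e

theorem ip_add (c : E → ℤ) (x y : E → ℝ) : ip c (x + y) = ip c x + ip c y := by
  simp [ip, mul_add, Finset.sum_add_distrib]

theorem ip_sub (c : E → ℤ) (x y : E → ℝ) : ip c (x - y) = ip c x - ip c y := by
  simp [ip, mul_sub, Finset.sum_sub_distrib]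

theorem ip_smul (c : E → ℤ) (t : ℝ) (x : E → ℝ) : ip c (t • x) = t * ip c x := by
  simp only [ip, Finset.mul_sum, Pi.smul_apply, smul_eq_mul]
  exact Finset.sum_congr rfl fun e _ => by ring

theorem ip_neg (c : E → ℤ) (x : E → ℝ) : ip (-c) x = -ip c x := by
  simp [ip, Finset.sum_neg_distrib]

theorem ip_eq_single {c : E → ℤ} {x : E → ℝ} {e : E} (h : ∀ f, f ≠ e → c f ≠ 0 → x f = 0) :
    ip c x = c e * x e := by
  refine Finset.sum_eq_single e (fun f _ hf => ?_) (by simp)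
  by_cases h0 : c f = 0
  · simp [h0]
  · simp [h f hf h0]

theorem abs_ip_le {c : E → ℤ} (hc : ∀ e, c e = 0 ∨ c e = 1 ∨ c e = -1) (x : E → ℝ) :
    |ip c x| ≤ ∑ e, |x e| := by
  refine (Finset.abs_sum_le_sum_abs _ _).trans (Finset.sum_le_sum fun e _ => ?_)
  rcases hc e with h | h | h <;> simp [h]

/-- The real vectors orthogonal to all cocircuits. -/
def flows (M : Digraphoid E) : Submodule ℝ (E → ℝ) where
  carrier := {x | ∀ d ∈ M.cocirc, ip d x = 0}
  zero_mem' d _ := by simp [ip]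
  add_mem' hx hy d hd := by rw [ip_add, hx d hd, hy d hd, add_zero]
  smul_mem' t x hx d hd := by rw [ip_smul, hx d hd, mul_zero]

/-- An integer vector as a real one. -/
def toReal (c : E → ℤ) : E → ℝ := fun e => c e

variable {M : Digraphoid E}

theorem toReal_mem_flows {c : E → ℤ} (hc : c ∈ M.circ) : toReal c ∈ M.flows := by
  intro d hd
  have h := M.orth c hc d hd
  have h2 : ((∑ e, c e * d e : ℤ) : ℝ) = 0 := by rw [h]; simp
  push_cast at h2
  rw [← h2]
  exact Finset.sum_congr rfl fun e _ => mul_comm _ _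

theorem ip_eq_of_sub_mem {x y : E → ℝ} (h : x - y ∈ M.flows) {d : E → ℤ} (hd : d ∈ M.cocirc) :
    ip d x = ip d y := by
  have := h d hd
  rw [ip_sub] at this
  linarith

theorem sq_eq_one_of_ne {c : E → ℤ} (hc : c ∈ M.circ) {e : E} (h : c e ≠ 0) :
    (c e : ℝ) * c e = 1 := by
  rcases M.circ_val c hc e with h' | h' | h'
  · exact absurd h' h
  all_goals simp [h']

/-- Paint by the signs of `x`. The cocircuit alternative is impossible: all terms of its pairing
with `x` would be nonnegative and the one at `e` positive, while the flow `x` pairs to zero. -/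
theorem exists_conformal_of_pos {x : E → ℝ} (hx : x ∈ M.flows) {e : E} (he : 0 < x e) :
    ∃ c ∈ M.circ, c e ≠ 0 ∧ ∀ f, c f ≠ 0 → 0 < c f * x f := by
  rcases M.painting {f | 0 < x f} {f | x f < 0} e with ⟨c, hc, h1, h⟩ | ⟨d, hd, h1, h⟩
  · refine ⟨c, hc, by simp [h1], fun f hf => ?_⟩
    by_cases hfe : f = e
    · subst hfe; simpa [h1] using he
    rcases M.circ_val c hc f with h' | h' | h'
    · exact absurd h' hf
    · simpa [h'] using (h f hfe).1 h'
    · simpa [h'] using (h f hfe).2 h'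
  · exfalso
    have h0 := hx d hd
    have : 0 < ip d x := by
      refine Finset.sum_pos' (fun f _ => ?_) ⟨e, Finset.mem_univ _, by simpa [h1] using he⟩
      by_cases hfe : f = e
      · subst hfe; simpa [h1] using he.le
      rcases M.cocirc_val d hd f with h' | h' | h'
      · simp [h']
      · have := (h f hfe).1 h'
        simpa [h'] using this
      · have := (h f hfe).2 h'
        simpa [h'] using this
    linarith

theorem exists_conformal {x : E → ℝ} (hx : x ∈ M.flows) {e : E} (he : x e ≠ 0) :
    ∃ c ∈ M.circ, c e ≠ 0 ∧ ∀ f, c f ≠ 0 → 0 < c f * x f := by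
  rcases he.lt_or_gt with h | h
  · obtain ⟨c, hc, hce, hcf⟩ := exists_conformal_of_pos (M.flows.neg_mem hx) (e := e)
      (by simpa using h)
    refine ⟨-c, M.circ_neg c hc, by simpa using hce, fun f hf => ?_⟩
    simpa using hcf f (by simpa using hf)
  · exact exists_conformal_of_pos hx h

theorem flow_eq_zero {x : E → ℝ} (hx : x ∈ M.flows)
    (h : ∀ c ∈ M.circ, ∃ f, c f ≠ 0 ∧ x f = 0) : x = 0 := by
  funext e
  by_contra he
  obtain ⟨c, hc, -, hcf⟩ := exists_conformal hx he
  obtain ⟨f, hf, hxf⟩ := h c hc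
  simpa [hxf] using hcf f hf

/-- Circuits span the flows: subtracting a multiple of a conformal circuit kills the coordinate `e`
without enlarging the support, so induction on the support reduces the claim to circuits, where it
is the definition of `M.dual.flows`. -/
theorem sum_mul_eq_zero {x z : E → ℝ} (hx : x ∈ M.flows) (hz : z ∈ M.dual.flows) :
    ∑ e, x e * z e = 0 := by
  classical
  induction hn : (Finset.univ.filter fun e => x e ≠ 0).card using Nat.strong_induction_on
    generalizing x with
  | _ n ih =>
    by_cases h0 : x = 0
    · simp [h0]
    obtain ⟨e, he⟩ := Function.ne_iff.1 h0
    obtain ⟨c, hc, hce, hcf⟩ := exists_conformal hx he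
    have hy := M.flows.sub_mem hx (M.flows.smul_mem (x e * c e) (toReal_mem_flows hc))
    have := ih _ ?_ hy rfl
    · have hcz : ip c z = 0 := hz c hc
      have e1 : ∑ f, (x - (x e * c e) • toReal c) f * z f =
          ∑ f, x f * z f - (x e * c e) * ip c z := by
        rw [ip, Finset.mul_sum, ← Finset.sum_sub_distrib]
        refine Finset.sum_congr rfl fun f _ => ?_
        simp only [Pi.sub_apply, Pi.smul_apply, smul_eq_mul, toReal]
        ring
      rw [e1, hcz] at this
      simpa using this
    · rw [← hn]
      refine Finset.card_lt_card ⟨fun f hf => ?_, fun hsub => ?_⟩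
      · simp only [Finset.mem_filter, Finset.mem_univ, true_and] at hf ⊢
        intro hxf
        apply hf
        have : c f = 0 := by
          by_contra hcf0
          simpa [hxf] using hcf f hcf0
        simp [toReal, hxf, this]
      · have := hsub (show e ∈ _ by simpa using he)
        simp only [Finset.mem_filter, Finset.mem_univ, true_and] at this
        apply this
        simp only [Pi.sub_apply, Pi.smul_apply, smul_eq_mul, toReal]
        linear_combination (-x e) * sq_eq_one_of_ne hc hce

/-- A set of elements which contains no circuit and meets every cocircuit. -/
structure IsBasis (M : Digraphoid E) (T : Set E) : Prop where
  circ : ∀ c ∈ M.circ, ∃ f, f ∉ T ∧ c f ≠ 0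
  cocirc : ∀ d ∈ M.cocirc, ∃ f, f ∈ T ∧ d f ≠ 0

theorem IsBasis.compl {T : Set E} (hT : M.IsBasis T) : M.dual.IsBasis Tᶜ :=
  ⟨fun d hd => by simpa using hT.cocirc d hd, hT.circ⟩

theorem IsBasis.exists_fundamental {T : Set E} (hT : M.IsBasis T) {e : E} (he : e ∉ T) :
    ∃ c ∈ M.circ, c e = 1 ∧ ∀ f, f ≠ e → c f ≠ 0 → f ∈ T := by
  rcases M.painting T T e with ⟨c, hc, h1, h⟩ | ⟨d, hd, h1, h⟩
  · refine ⟨c, hc, h1, fun f hf hcf => ?_⟩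
    rcases M.circ_val c hc f with h' | h' | h'
    · exact absurd h' hcf
    · exact (h f hf).1 h'
    · exact (h f hf).2 h'
  · exfalso
    obtain ⟨f, hfT, hf⟩ := hT.cocirc d hd
    have hfe : f ≠ e := fun h => he (h ▸ hfT)
    rcases M.cocirc_val d hd f with h' | h' | h'
    · exact hf h'
    · exact (h f hfe).1 h' hfT
    · exact (h f hfe).2 h' hfT

/-- Each coordinate of `p` off `T` is cancelled by its own fundamental circuit, which meets the
complement of `T` nowhere else. -/
theorem IsBasis.exists_basic_solution {T : Set E} (hT : M.IsBasis T) (p : E → ℝ) :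
    ∃ x, x - p ∈ M.flows ∧ ∀ e, e ∉ T → x e = 0 := by
  classical
  choose c hc h1 h using fun e : {e // e ∉ T} => hT.exists_fundamental e.2
  refine ⟨p - ∑ e : {e // e ∉ T}, p e • toReal (c e), ?_, fun e he => ?_⟩
  · rw [sub_sub_cancel_left]
    exact M.flows.neg_mem (Submodule.sum_mem _ fun e _ =>
      M.flows.smul_mem _ (toReal_mem_flows (hc e)))
  · simp only [Pi.sub_apply, Finset.sum_apply, Pi.smul_apply, smul_eq_mul, toReal]
    rw [Finset.sum_eq_single ⟨e, he⟩]
    · simp [h1]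
    · intro f _ hf
      have : c f e = 0 := by
        by_contra h0
        exact he (h f e (fun h' => hf (Subtype.ext h'.symm)) h0)
      simp [this]
    · simp

/-! ### Linear programming: a basis for every compatible orientation -/

/-- All circuits conforming to `o` are positive on `w`. -/
def Compat (M : Digraphoid E) (w : E → ℝ) (o : E → ℤˣ) : Prop :=
  ∀ c ∈ M.circ, Conforms c o → 0 < ip c w

/-- No circuit vanishes on `w`. -/
def Generic (M : Digraphoid E) (w : E → ℝ) : Prop := ∀ c ∈ M.circ, ip c w ≠ 0

/-- `x` is in the coset of `p` modulo flows and its signs are weakly those of `o`. -/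
structure Feasible (M : Digraphoid E) (p : E → ℝ) (o : E → ℤˣ) (x : E → ℝ) : Prop where
  mem : x - p ∈ M.flows
  nonneg : ∀ e, 0 ≤ sg o e * x e

/-- The tree `T` is matched with `o`, as witnessed by a primal and a dual basic solution. -/
structure IsGeo (M : Digraphoid E) (w wd : E → ℝ) (T : Set E) (o : E → ℤˣ) (x z : E → ℝ) :
    Prop where
  x_mem : x - wd ∈ M.flows
  z_mem : z - w ∈ M.dual.flows
  on : ∀ e, e ∈ T → 0 < sg o e * x e ∧ z e = 0
  off : ∀ e, e ∉ T → x e = 0 ∧ 0 < sg o e * z e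

theorem exists_min_abs (x : E → ℝ) : ∃ ε > 0, ∀ f, x f ≠ 0 → ε ≤ |x f| := by
  classical
  by_cases h : (Finset.univ.filter fun f => x f ≠ 0).Nonempty
  · obtain ⟨f, hf, hmin⟩ := Finset.exists_min_image _ (fun f => |x f|) h
    refine ⟨|x f|, abs_pos.2 (by simpa using hf), fun g hg => hmin g (by simpa using hg)⟩
  · refine ⟨1, one_pos, fun f hf => absurd ⟨f, ?_⟩ h⟩
    simpa using hf

theorem sum_mul_add_smul (w x : E → ℝ) (t : ℝ) (c : E → ℤ) :
    ∑ e, w e * (x + t • toReal c) e = ∑ e, w e * x e + t * ip c w := by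
  rw [ip, Finset.mul_sum, ← Finset.sum_add_distrib]
  refine Finset.sum_congr rfl fun e _ => ?_
  simp only [Pi.add_apply, Pi.smul_apply, smul_eq_mul, toReal]
  ring

theorem exists_neg_circ {w : E → ℝ} (hw : M.Generic w) {c : E → ℤ} (hc : c ∈ M.circ) :
    ∃ c' ∈ M.circ, ip c' w < 0 ∧ ∀ e, c' e ≠ 0 → c e ≠ 0 := by
  rcases (hw c hc).lt_or_gt with h | h
  · exact ⟨c, hc, h, fun _ => id⟩
  · exact ⟨-c, M.circ_neg c hc, by rw [ip_neg]; linarith, fun e => by simp⟩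

/-- A descent to a vertex. If a circuit lies in the support of `x`, direct it so that `w` decreases
along it; by compatibility it opposes `o` somewhere, so moving along it reaches the boundary of the
feasible set, which removes an element from the support. -/
theorem Feasible.reduce {p w x : E → ℝ} {o : E → ℤˣ} (hx : M.Feasible p o x)
    (hw : M.Generic w) (ho : M.Compat w o) :
    ∃ y, M.Feasible p o y ∧ (∀ c ∈ M.circ, ∃ f, c f ≠ 0 ∧ y f = 0) ∧
      ∑ e, w e * y e ≤ ∑ e, w e * x e := by
  classical
  induction hn : (Finset.univ.filter fun e => x e ≠ 0).card using Nat.strong_induction_on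
    generalizing x with
  | _ n ih =>
    by_cases h : ∀ c ∈ M.circ, ∃ f, c f ≠ 0 ∧ x f = 0
    · exact ⟨x, hx, h, le_rfl⟩
    push Not at h
    obtain ⟨c₀, hc₀, h₀⟩ := h
    obtain ⟨c, hc, hneg, hcc⟩ := exists_neg_circ hw hc₀
    have hsupp : ∀ f, c f ≠ 0 → x f ≠ 0 := fun f hf => h₀ f (hcc f hf)
    have hnc : ¬ Conforms c o := fun h => (ho c hc h).not_gt hneg
    have hB : (Finset.univ.filter fun f => c f ≠ 0 ∧ c f ≠ (o f : ℤ)).Nonempty := by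
      unfold Conforms at hnc
      push Not at hnc
      obtain ⟨f, hf⟩ := hnc
      exact ⟨f, by simpa using hf⟩
    -- Ratio test: the longest feasible step is the least value of `x`, measured along `o`, on the
    -- elements where `c` opposes `o`.
    obtain ⟨f, hf, hmin⟩ := Finset.exists_min_image _ (fun f => sg o f * x f) hB
    simp only [Finset.mem_filter, Finset.mem_univ, true_and] at hf hmin
    have hval : ∀ g, c g ≠ 0 → c g ≠ (o g : ℤ) → (c g : ℝ) = -sg o g := by
      intro g h1 h2
      rcases M.circ_val c hc g with h' | h' | h' <;>
        rcases Int.units_eq_one_or (o g) with h'' | h'' <;> simp_all [sg]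
    set t := sg o f * x f with ht
    have ht0 : 0 ≤ t := hx.nonneg f
    have hy : M.Feasible p o (x + t • toReal c) := by
      refine ⟨?_, fun g => ?_⟩
      · rw [add_sub_right_comm]
        exact M.flows.add_mem hx.mem (M.flows.smul_mem _ (toReal_mem_flows hc))
      · simp only [Pi.add_apply, Pi.smul_apply, smul_eq_mul, toReal]
        have hg := hx.nonneg g
        by_cases h1 : c g = 0
        · simpa [h1] using hg
        by_cases h2 : c g = (o g : ℤ)
        · have : (c g : ℝ) = sg o g := by rw [h2]; rfl
          rw [this]
          nlinarith [sg_mul_self o g]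
        · rw [hval g h1 h2]
          have := hmin g ⟨h1, h2⟩
          nlinarith [sg_mul_self o g]
    have hrec := ih _ ?_ hy rfl
    · obtain ⟨y, hy1, hy2, hy3⟩ := hrec
      refine ⟨y, hy1, hy2, hy3.trans ?_⟩
      rw [sum_mul_add_smul]
      nlinarith
    · rw [← hn]
      refine Finset.card_lt_card ⟨fun g hg => ?_, fun hsub => ?_⟩
      · simp only [Finset.mem_filter, Finset.mem_univ, true_and] at hg ⊢
        intro hxg
        apply hg
        have : c g = 0 := by
          by_contra hcf0
          exact hsupp g hcf0 hxg
        simp [toReal, hxg, this]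
      · have := hsub (show f ∈ _ by simpa using hsupp f hf.1)
        simp only [Finset.mem_filter, Finset.mem_univ, true_and] at this
        apply this
        simp only [Pi.add_apply, Pi.smul_apply, smul_eq_mul, toReal]
        rw [hval f hf.1 hf.2]
        linear_combination (-x f) * sg_mul_self o f

/-- Genericity of `p` is nondegeneracy: a cocircuit missing the support of `x` would pair to zero
with `x`, hence with `p`. -/
theorem isBasis_support {p x : E → ℝ} (hp : M.dual.Generic p) (hx : x - p ∈ M.flows)
    (h : ∀ c ∈ M.circ, ∃ f, c f ≠ 0 ∧ x f = 0) : M.IsBasis {e | x e ≠ 0} := by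
  refine ⟨fun c hc => ?_, fun d hd => ?_⟩
  · obtain ⟨f, h1, h2⟩ := h c hc
    exact ⟨f, by simpa using h2, h1⟩
  · by_contra hcon
    push Not at hcon
    apply hp d hd
    rw [← ip_eq_of_sub_mem hx hd]
    refine Finset.sum_eq_zero fun e _ => ?_
    by_cases he : x e = 0
    · simp [he]
    · simp [hcon e he]

theorem IsBasis.ne_zero {T : Set E} (hT : M.IsBasis T) {p x : E → ℝ} (hp : M.dual.Generic p)
    (hx : x - p ∈ M.flows) (hxT : ∀ e, e ∉ T → x e = 0) {e : E} (he : e ∈ T) : x e ≠ 0 := by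
  obtain ⟨d, hd, h1, h⟩ := hT.compl.exists_fundamental (e := e) (by simpa using he)
  have := hp d hd
  rw [← ip_eq_of_sub_mem hx hd, ip_eq_single (fun f hf hdf => hxT f (h f hf hdf)), h1] at this
  simpa using this

/-- Choose an optimal vertex. Its support is a basis, and the dual basic solution `z` gives the
reduced costs: if one had the wrong sign, a small move along the corresponding fundamental circuit,
followed by a descent, would improve the optimum. -/
theorem Feasible.exists_isGeo {p w x : E → ℝ} {o : E → ℤˣ} (hx : M.Feasible p o x)
    (hp : M.dual.Generic p) (hw : M.Generic w) (ho : M.Compat w o) :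
    ∃ T y z, M.IsGeo w p T o y z := by
  let F : Set (E → ℝ) := {y | M.Feasible p o y ∧ ∀ c ∈ M.circ, ∃ f, c f ≠ 0 ∧ y f = 0}
  -- A vertex is determined by its support, since the difference of two with the same support
  -- vanishes somewhere on every circuit.
  have hF : F.Finite := by
    refine Set.Finite.of_injOn (f := fun y => {e | y e ≠ 0}) (t := Set.univ)
      (fun _ _ => Set.mem_univ _) ?_ Set.finite_univ
    intro y hy y' hy' hyy
    have hyy' : ∀ e, y e = 0 ↔ y' e = 0 := fun e => not_iff_not.1 (Set.ext_iff.1 hyy e)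
    have hsub : y - y' ∈ M.flows := by
      have := M.flows.sub_mem hy.1.mem hy'.1.mem
      rwa [sub_sub_sub_cancel_right] at this
    refine sub_eq_zero.1 (flow_eq_zero hsub fun c hc => ?_)
    obtain ⟨f, h1, h2⟩ := hy.2 c hc
    exact ⟨f, h1, by simp [h2, (hyy' f).1 h2]⟩
  obtain ⟨x', hx1, hx2, -⟩ := hx.reduce hw ho
  obtain ⟨y, hyF, hmin⟩ := Set.exists_min_image F (fun y => ∑ e, w e * y e) hF ⟨x', hx1, hx2⟩
  have hT := isBasis_support hp hyF.1.mem hyF.2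
  obtain ⟨z, hz, hzT⟩ := hT.compl.exists_basic_solution w
  refine ⟨_, y, z, hyF.1.mem, hz, fun e he => ⟨?_, hzT e (not_not.2 he)⟩,
    fun e he => ⟨not_not.1 he, ?_⟩⟩
  · refine lt_of_le_of_ne (hyF.1.nonneg e) (Ne.symm (mul_ne_zero ?_ he))
    rcases sg_eq o e with h | h <;> simp [h]
  have hze : z e ≠ 0 := hT.compl.ne_zero hw hz hzT he
  by_contra hneg
  have hneg' : sg o e * z e < 0 := lt_of_le_of_ne (not_lt.1 hneg)
    (mul_ne_zero (by rcases sg_eq o e with h | h <;> simp [h]) hze)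
  obtain ⟨c, hc, h1, h⟩ := hT.exists_fundamental he
  have hcw : ip c w = z e := by
    rw [← ip_eq_of_sub_mem hz hc, ip_eq_single (e := e), h1]
    · simp
    · intro f hf hcf
      exact hzT f (not_not.2 (h f hf hcf))
  obtain ⟨ε, hε, hmin'⟩ := exists_min_abs y
  -- At `e` the move creates the sign of `o`; elsewhere the circuit stays in the support of `y`,
  -- where all values have size at least `ε`.
  have hfeas : M.Feasible p o (y + (ε * sg o e) • toReal c) := by
    refine ⟨?_, fun f => ?_⟩
    · rw [add_sub_right_comm]
      exact M.flows.add_mem hyF.1.mem (M.flows.smul_mem _ (toReal_mem_flows hc))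
    · simp only [Pi.add_apply, Pi.smul_apply, smul_eq_mul, toReal]
      by_cases hfe : f = e
      · subst hfe
        rw [not_not.1 he, h1]
        simp only [Int.cast_one]
        nlinarith [sg_mul_self o f]
      by_cases hcf : c f = 0
      · simpa [hcf] using hyF.1.nonneg f
      have hyf := hmin' f (h f hfe hcf)
      have hnn := hyF.1.nonneg f
      have : |y f| = sg o f * y f := by
        rcases sg_eq o f with h' | h' <;> rw [h'] at hnn ⊢
        · rw [abs_of_nonneg (by linarith)]; ring
        · rw [abs_of_nonpos (by linarith)]; ring
      rw [this] at hyf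
      rcases sg_eq o f with h' | h' <;> rcases sg_eq o e with h'' | h'' <;>
        rcases M.circ_val c hc f with h3 | h3 | h3 <;> simp only [h', h'', h3] at hyf ⊢ <;>
        push_cast <;> linarith
  obtain ⟨y', hy1, hy2, hy3⟩ := hfeas.reduce hw ho
  have := hmin y' ⟨hy1, hy2⟩
  rw [sum_mul_add_smul, hcw] at hy3
  nlinarith

/-- The nonzero digit of lowest index `i` makes the sum nonzero modulo `2 ^ (i + 1)`. -/
theorem sum_two_pow_ne_zero {n : ℕ} (a : Fin n → ℤ) (ha : ∀ i, a i = 0 ∨ a i = 1 ∨ a i = -1)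
    (hne : ∃ i, a i ≠ 0) : ∑ i, a i * 2 ^ (i : ℕ) ≠ 0 := by
  classical
  have hne' : (Finset.univ.filter fun i => a i ≠ 0).Nonempty := by
    obtain ⟨i, hi⟩ := hne
    exact ⟨i, by simpa using hi⟩
  obtain ⟨i, hi, hmin⟩ := Finset.exists_min_image _ (fun i : Fin n => (i : ℕ)) hne'
  simp only [Finset.mem_filter, Finset.mem_univ, true_and] at hi hmin
  intro h
  rw [← Finset.add_sum_erase _ _ (Finset.mem_univ i)] at h
  have hdvd : (2 : ℤ) ^ ((i : ℕ) + 1) ∣ ∑ j ∈ Finset.univ.erase i, a j * 2 ^ (j : ℕ) := by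
    refine Finset.dvd_sum fun j hj => ?_
    by_cases h0 : a j = 0
    · simp [h0]
    refine Dvd.dvd.mul_left (pow_dvd_pow 2 ?_) _
    have h1 := hmin j h0
    have h2 : (j : ℕ) ≠ i := fun h => (Finset.ne_of_mem_erase hj) (Fin.ext h)
    omega
  have hdvd2 : (2 : ℤ) ^ ((i : ℕ) + 1) ∣ a i * 2 ^ (i : ℕ) := by
    rw [eq_neg_of_add_eq_zero_left h]
    exact hdvd.neg_right
  rw [pow_succ, mul_comm] at hdvd2
  have := Int.dvd_of_mul_dvd_mul_right (by positivity) hdvd2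
  rcases ha i with h' | h' | h' <;> rw [h'] at this <;> first | exact hi h' | norm_num at this

theorem exists_generic_conforming (M : Digraphoid E) (o : E → ℤˣ) :
    ∃ p : E → ℝ, M.Generic p ∧ ∀ e, 0 ≤ sg o e * p e := by
  let i := Fintype.equivFin E
  refine ⟨fun e => sg o e * 2 ^ (i e : ℕ), fun c hc h => ?_, fun e => ?_⟩
  · obtain ⟨e, he⟩ := M.circ_ne c hc
    refine sum_two_pow_ne_zero (fun j => c (i.symm j) * (o (i.symm j) : ℤ)) (fun j => ?_)
      ⟨i e, by simpa using he⟩ ?_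
    · rcases M.circ_val c hc (i.symm j) with h' | h' | h' <;>
        rcases Int.units_eq_one_or (o (i.symm j)) with h'' | h'' <;> simp [h', h'']
    · rw [← i.sum_comp]
      simp only [Equiv.symm_apply_apply]
      have : ((∑ e, c e * (o e : ℤ) * 2 ^ (i e : ℕ) : ℤ) : ℝ) = 0 := by
        rw [← h, ip]
        push_cast
        exact Finset.sum_congr rfl fun e _ => by rw [sg]; ring
      exact_mod_cast this
  · rw [← mul_assoc, sg_mul_self]
    positivity

/-- Two programs are solved. The first, on the dual side, starts from an auxiliary generic point
conforming to `o`; its dual solution is a feasible start for the second, which has the wanted data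
`w` and `wd`. -/
theorem exists_isGeo {w wd : E → ℝ} (hw : M.Generic w) (hwd : M.dual.Generic wd) {o : E → ℤˣ}
    (ho : M.Compat w o) (hod : M.dual.Compat wd o) : ∃ T x z, M.IsGeo w wd T o x z := by
  obtain ⟨p, hp, hpo⟩ := exists_generic_conforming M o
  have hfeas : M.dual.Feasible p o p := ⟨by simp, hpo⟩
  obtain ⟨T, y, z, h⟩ := hfeas.exists_isGeo hp hwd hod
  have hz : M.Feasible wd o z := by
    refine ⟨h.z_mem, fun e => ?_⟩
    by_cases he : e ∈ T
    · simp [(h.on e he).2]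
    · exact (h.off e he).2.le
  exact hz.exists_isGeo hwd hw ho

end Digraphoid

/-! ### The tree and the orientation of a matched pair determine each other -/

namespace Digraphoid

variable {E : Type*}

theorem sg_eq_of_pos {o o' : E → ℤˣ} {e : E} {t : ℝ} (h : 0 < sg o e * t) (h' : 0 < sg o' e * t) :
    o e = o' e := by
  apply eq_of_sg_eq
  rcases sg_eq o e with h1 | h1 <;> rcases sg_eq o' e with h2 | h2 <;> rw [h1] at h ⊢ <;>
    rw [h2] at h' ⊢ <;> linarith

theorem sg_mul_intCast {c : E → ℤ} {o : E → ℤˣ} {e : E} (h : c e = (o e : ℤ)) :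
    (c e : ℝ) = sg o e := by
  rw [h]; rfl

open Classical in
/-- Reversal of the elements of `A`. -/
noncomputable def flip (o : E → ℤˣ) (A : Set E) : E → ℤˣ := fun e => if e ∈ A then -o e else o e

theorem flip_of_mem {o : E → ℤˣ} {A : Set E} {e : E} (h : e ∈ A) : flip o A e = -o e := if_pos h

theorem flip_of_notMem {o : E → ℤˣ} {A : Set E} {e : E} (h : e ∉ A) : flip o A e = o e := if_neg h

theorem sg_flip_of_mem {o : E → ℤˣ} {A : Set E} {e : E} (h : e ∈ A) :
    sg (flip o A) e = -sg o e := by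
  simp [sg, flip_of_mem h]

theorem sg_flip_of_notMem {o : E → ℤˣ} {A : Set E} {e : E} (h : e ∉ A) :
    sg (flip o A) e = sg o e := by
  simp [sg, flip_of_notMem h]

/-- The part of `o` on `A`, as a real vector. -/
noncomputable def part (o : E → ℤˣ) (A : Set E) : E → ℝ := A.indicator (sg o)

theorem part_of_mem {o : E → ℤˣ} {A : Set E} {e : E} (h : e ∈ A) : part o A e = sg o e :=
  Set.indicator_of_mem h _

theorem part_of_notMem {o : E → ℤˣ} {A : Set E} {e : E} (h : e ∉ A) : part o A e = 0 :=
  Set.indicator_of_notMem h _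

theorem part_eq_neg {o' : E → ℤˣ} {A : Set E} (h : ∀ e, e ∈ A → o e = -o' e) :
    part o A = -part o' A := by
  funext e
  by_cases he : e ∈ A
  · simp [part_of_mem he, sg, h e he]
  · simp [part_of_notMem he]

variable [Fintype E] {M : Digraphoid E} {w wd : E → ℝ} {o : E → ℤˣ}

theorem IsGeo.dual {T : Set E} {x z : E → ℝ} (h : M.IsGeo w wd T o x z) :
    M.dual.IsGeo wd w Tᶜ o z x :=
  ⟨h.z_mem, h.x_mem, fun e he => (h.off e he).symm, fun e he => (h.on e (not_not.1 he)).symm⟩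

theorem IsGeo.isBasis {T : Set E} {x z : E → ℝ} (h : M.IsGeo w wd T o x z)
    (hw : M.Generic w) (hwd : M.dual.Generic wd) : M.IsBasis T := by
  have key : ∀ {M : Digraphoid E} {w wd : E → ℝ} {T : Set E} {x z : E → ℝ},
      M.IsGeo w wd T o x z → M.Generic w → ∀ c ∈ M.circ, ∃ f, f ∉ T ∧ c f ≠ 0 := by
    intro M w wd T x z h hw c hc
    by_contra hcon
    push Not at hcon
    apply hw c hc
    rw [← ip_eq_of_sub_mem h.z_mem hc]
    refine Finset.sum_eq_zero fun e _ => ?_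
    by_cases he : e ∈ T
    · simp [(h.on e he).2]
    · simp [hcon e he]
  exact ⟨key h hw, fun d hd => by simpa using key h.dual hwd d hd⟩

/-- On a circuit `w` may be replaced by `z`, whose signs are weakly those of `o`. -/
theorem IsGeo.compat {T : Set E} {x z : E → ℝ} (h : M.IsGeo w wd T o x z) (hw : M.Generic w) :
    M.Compat w o := by
  intro c hc hco
  refine lt_of_le_of_ne ?_ (hw c hc).symm
  rw [← ip_eq_of_sub_mem h.z_mem hc]
  refine Finset.sum_nonneg fun e _ => ?_
  by_cases he : e ∈ T
  · simp [(h.on e he).2]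
  by_cases hce : c e = 0
  · simp [hce]
  · rw [sg_mul_intCast (hco e hce)]
    exact (h.off e he).2.le

/-- Complementary slackness: the differences of the primal and of the dual solutions are orthogonal,
yet each term of their product is nonpositive, and it is strictly negative at an element of exactly
one of the two trees. -/
theorem IsGeo.subset {T T' : Set E} {x z x' z' : E → ℝ} (h : M.IsGeo w wd T o x z)
    (h' : M.IsGeo w wd T' o x' z') : T ⊆ T' := by
  have hx := M.flows.sub_mem h.x_mem h'.x_mem
  have hz := M.dual.flows.sub_mem h.z_mem h'.z_mem
  rw [sub_sub_sub_cancel_right] at hx hz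
  have hsum := sum_mul_eq_zero hx hz
  have hle : ∀ e ∈ Finset.univ, (x - x') e * (z - z') e ≤ 0 := by
    intro e _
    simp only [Pi.sub_apply]
    by_cases he : e ∈ T <;> by_cases he' : e ∈ T'
    · simp [(h.on e he).2, (h'.on e he').2]
    · rw [(h.on e he).2, (h'.off e he').1]
      nlinarith [mul_pos (h.on e he).1 (h'.off e he').2, sg_mul_self o e]
    · rw [(h.off e he).1, (h'.on e he').2]
      nlinarith [mul_pos (h'.on e he').1 (h.off e he).2, sg_mul_self o e]
    · simp [(h.off e he).1, (h'.off e he').1]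
  intro e he
  by_contra he'
  have h0 := (Finset.sum_eq_zero_iff_of_nonpos hle).1 hsum e (Finset.mem_univ _)
  simp only [Pi.sub_apply] at h0
  rw [(h.on e he).2, (h'.off e he').1] at h0
  nlinarith [mul_pos (h.on e he).1 (h'.off e he').2, sg_mul_self o e]

theorem IsGeo.tree_unique {T T' : Set E} {x z x' z' : E → ℝ} (h : M.IsGeo w wd T o x z)
    (h' : M.IsGeo w wd T' o x' z') : T = T' :=
  (h.subset h').antisymm (h'.subset h)

theorem IsBasis.eq_of_support {T : Set E} (hT : M.IsBasis T) {p x x' : E → ℝ}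
    (hx : x - p ∈ M.flows) (hx' : x' - p ∈ M.flows) (h : ∀ e, e ∉ T → x e = 0)
    (h' : ∀ e, e ∉ T → x' e = 0) : x = x' := by
  have hs := M.flows.sub_mem hx hx'
  rw [sub_sub_sub_cancel_right] at hs
  refine sub_eq_zero.1 (flow_eq_zero hs fun c hc => ?_)
  obtain ⟨f, hf, hcf⟩ := hT.circ c hc
  exact ⟨f, hcf, by simp [h f hf, h' f hf]⟩

theorem IsBasis.exists_isGeo {T : Set E} (hT : M.IsBasis T) (hw : M.Generic w)
    (hwd : M.dual.Generic wd) : ∃ o x z, M.IsGeo w wd T o x z := by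
  classical
  obtain ⟨x, hx, hxT⟩ := hT.exists_basic_solution wd
  obtain ⟨z, hz, hzT⟩ := hT.compl.exists_basic_solution w
  have key : ∀ {t s : ℝ}, t ≠ 0 → s = 0 →
      0 < ((((if 0 < t + s then 1 else -1 : ℤˣ) : ℤ)) : ℝ) * t := by
    intro t s ht hs
    rcases ht.lt_or_gt with h | h
    · rw [if_neg (by linarith)]
      push_cast
      linarith
    · rw [if_pos (by linarith)]
      push_cast
      linarith
  -- At each element exactly one of `x` and `z` is nonzero, so the sum has the sign of that one.
  refine ⟨fun e => if 0 < x e + z e then 1 else -1, x, z, hx, hz, fun e he => ?_, fun e he => ?_⟩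
  · have hze := hzT e (not_not.2 he)
    exact ⟨key (hT.ne_zero hwd hx hxT he) hze, hze⟩
  · have hxe := hxT e he
    refine ⟨hxe, ?_⟩
    have := key (hT.compl.ne_zero hw hz hzT he) hxe
    rwa [add_comm] at this

theorem IsGeo.orientation_unique {o' : E → ℤˣ} {T : Set E} {x z x' z' : E → ℝ}
    (h : M.IsGeo w wd T o x z) (h' : M.IsGeo w wd T o' x' z') (hw : M.Generic w)
    (hwd : M.dual.Generic wd) : o = o' := by
  have hT := h.isBasis hw hwd
  have hx := hT.eq_of_support h.x_mem h'.x_mem (fun e he => (h.off e he).1)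
    fun e he => (h'.off e he).1
  have hz := hT.compl.eq_of_support h.z_mem h'.z_mem (fun e he => (h.on e (not_not.1 he)).2)
    fun e he => (h'.on e (not_not.1 he)).2
  subst hx hz
  funext e
  by_cases he : e ∈ T
  · exact sg_eq_of_pos (h.on e he).1 (h'.on e he).1
  · exact sg_eq_of_pos (h.off e he).2 (h'.off e he).2

/-! ### Reversing flows and coflows to reach a compatible orientation -/

theorem notMem_of_part_mem {A B : Set E} (hA : part o A ∈ M.flows)
    (hB : part o B ∈ M.dual.flows) {e : E} (he : e ∈ A) : e ∉ B := by
  intro he'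
  have hle : ∀ e ∈ Finset.univ, 0 ≤ part o A e * part o B e := by
    intro e _
    by_cases h1 : e ∈ A
    · by_cases h2 : e ∈ B
      · rw [part_of_mem h1, part_of_mem h2, sg_mul_self]; exact zero_le_one
      · simp [part_of_notMem h2]
    · simp [part_of_notMem h1]
  have := (Finset.sum_eq_zero_iff_of_nonneg hle).1 (sum_mul_eq_zero hA hB) e (Finset.mem_univ _)
  rw [part_of_mem he, part_of_mem he', sg_mul_self] at this
  exact one_ne_zero this

/-- A circuit of negative weight in the reversed orientation avoids `B` by orthogonality. Adding it
to the restriction of `o` to `A` gives the restriction to a symmetric difference, a flow of smaller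
weight than the minimum. -/
theorem compat_flip_of_minimal (hw : M.Generic w) {A B : Set E} (hA : part o A ∈ M.flows)
    (hB : part o B ∈ M.dual.flows)
    (hmin : ∀ A', part o A' ∈ M.flows → ∑ e, w e * part o A e ≤ ∑ e, w e * part o A' e) :
    M.Compat w (flip o (A ∪ B)) := by
  intro c hc hco
  by_contra hneg
  have hneg' : ip c w < 0 := lt_of_le_of_ne (not_lt.1 hneg) (hw c hc)
  have hcB : ∀ e, e ∈ B → c e = 0 := by
    have hle : ∀ e ∈ Finset.univ, (c e : ℝ) * part o B e ≤ 0 := by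
      intro e _
      by_cases h1 : c e = 0
      · simp [h1]
      by_cases h2 : e ∈ B
      · rw [sg_mul_intCast (hco e h1), sg_flip_of_mem (Set.mem_union_right _ h2), part_of_mem h2]
        nlinarith [sg_mul_self o e]
      · simp [part_of_notMem h2]
    intro e he
    by_contra h1
    have := (Finset.sum_eq_zero_iff_of_nonpos hle).1 (hB c hc) e (Finset.mem_univ _)
    rw [sg_mul_intCast (hco e h1), sg_flip_of_mem (Set.mem_union_right _ he), part_of_mem he] at this
    nlinarith [sg_mul_self o e]
  have hA' : part o (symmDiff A {e | c e ≠ 0}) = part o A + (1 : ℝ) • toReal c := by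
    funext e
    simp only [one_smul, Pi.add_apply, toReal]
    by_cases h1 : c e = 0
    · by_cases h2 : e ∈ A
      · rw [part_of_mem h2, part_of_mem (by simp [Set.mem_symmDiff, h1, h2]), h1]; simp
      · rw [part_of_notMem h2, h1, part_of_notMem (by simp [Set.mem_symmDiff, h1, h2])]; simp
    · have h3 : e ∉ B := fun h => h1 (hcB e h)
      rw [sg_mul_intCast (hco e h1)]
      by_cases h2 : e ∈ A
      · rw [part_of_mem h2, sg_flip_of_mem (Set.mem_union_left _ h2),
          part_of_notMem (by simp [Set.mem_symmDiff, h1, h2])]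
        simp
      · rw [part_of_notMem h2, sg_flip_of_notMem (by simp [h2, h3]),
          part_of_mem (by simp [Set.mem_symmDiff, h1, h2])]
        simp
  have := hmin (symmDiff A {e | c e ≠ 0}) (by
    rw [hA', one_smul]
    exact M.flows.add_mem hA (toReal_mem_flows hc))
  rw [hA', sum_mul_add_smul] at this
  linarith

theorem exists_minimal_part (M : Digraphoid E) (w : E → ℝ) (o : E → ℤˣ) :
    ∃ A, part o A ∈ M.flows ∧
      ∀ A', part o A' ∈ M.flows → ∑ e, w e * part o A e ≤ ∑ e, w e * part o A' e :=
  Set.exists_min_image {A | part o A ∈ M.flows} (fun A => ∑ e, w e * part o A e)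
    (Set.toFinite _) ⟨∅, by
      have : part o ∅ = 0 := Set.indicator_empty _
      simp [this]⟩

theorem exists_compat_flip (hw : M.Generic w) (hwd : M.dual.Generic wd) (o : E → ℤˣ) :
    ∃ A B, part o A ∈ M.flows ∧ part o B ∈ M.dual.flows ∧ M.Compat w (flip o (A ∪ B)) ∧
      M.dual.Compat wd (flip o (A ∪ B)) := by
  obtain ⟨A, hA, hA'⟩ := exists_minimal_part M w o
  obtain ⟨B, hB, hB'⟩ := exists_minimal_part M.dual wd o
  refine ⟨A, B, hA, hB, compat_flip_of_minimal hw hA hB hA', ?_⟩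
  rw [Set.union_comm]
  exact compat_flip_of_minimal hwd hB hA hB'

/-- A circuit conformal to the difference of the two flows conforms to one reversed orientation and
its negative conforms to the other, so both would have positive weight. -/
theorem eq_of_compat_flip {A B A' B' : Set E} (hA : part o A ∈ M.flows)
    (hB : part o B ∈ M.dual.flows) (hA' : part o A' ∈ M.flows) (hB' : part o B' ∈ M.dual.flows)
    (h : M.Compat w (flip o (A ∪ B))) (h' : M.Compat w (flip o (A' ∪ B'))) : A = A' := by
  by_contra hne
  have hflow := M.flows.sub_mem hA hA'
  obtain ⟨e, he⟩ : ∃ e, (part o A - part o A') e ≠ 0 := by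
    by_contra hcon
    push Not at hcon
    apply hne
    ext e
    have := hcon e
    have hs := sg_mul_self o e
    simp only [Pi.sub_apply] at this
    by_cases h1 : e ∈ A <;> by_cases h2 : e ∈ A' <;> simp only [h1, h2]
    · rw [part_of_mem h1, part_of_notMem h2] at this
      rw [sub_zero] at this
      simp [this] at hs
    · rw [part_of_notMem h1, part_of_mem h2] at this
      rw [zero_sub, neg_eq_zero] at this
      simp [this] at hs
  obtain ⟨c, hc, -, hcf⟩ := exists_conformal hflow he
  have hval : ∀ f, c f ≠ 0 → c f = (flip o (A' ∪ B') f : ℤ) ∧ c f = -(flip o (A ∪ B) f : ℤ) := by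
    intro f hf
    have := hcf f hf
    simp only [Pi.sub_apply] at this
    have hc1 := M.circ_val c hc f
    by_cases h1 : f ∈ A <;> by_cases h2 : f ∈ A'
    · simp [part_of_mem h1, part_of_mem h2] at this
    · rw [part_of_mem h1, part_of_notMem h2] at this
      rw [flip_of_mem (Set.mem_union_left _ h1),
        flip_of_notMem (by simp [h2, notMem_of_part_mem hA hB' h1])]
      unfold sg at this
      rcases hc1 with h3 | h3 | h3 <;> rcases Int.units_eq_one_or (o f) with h4 | h4 <;>
        simp [h3, h4] at this ⊢ <;> linarith
    · rw [part_of_notMem h1, part_of_mem h2] at this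
      rw [flip_of_mem (Set.mem_union_left _ h2),
        flip_of_notMem (by simp [h1, notMem_of_part_mem hA' hB h2])]
      unfold sg at this
      rcases hc1 with h3 | h3 | h3 <;> rcases Int.units_eq_one_or (o f) with h4 | h4 <;>
        simp [h3, h4] at this ⊢ <;> linarith
    · simp [part_of_notMem h1, part_of_notMem h2] at this
  have h1 := h' c hc fun f hf => (hval f hf).1
  have h2 := h (-c) (M.circ_neg c hc) fun f hf => by
    have := (hval f (by simpa using hf)).2
    simp [this]
  rw [ip_neg] at h2
  linarith

/-! ### The staircase argument for injectivity -/

/-- A point over `o` and `S` on the staircase in each coordinate: `x` and `z` are perturbed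
solutions, and the pair `(o e * x e, o e * z e)` determines whether `e` is in `S`. -/
structure IsStair (M : Digraphoid E) (w wd : E → ℝ) (N : ℝ) (S : Set E) (o : E → ℤˣ)
    (x z : E → ℝ) : Prop where
  x_mem : x - wd ∈ M.flows
  z_mem : z - w ∈ M.dual.flows
  on : ∀ e, e ∈ S → (0 < sg o e * x e ∧ sg o e * x e < N ∧ z e = 0) ∨
    (sg o e * x e = N ∧ sg o e * z e < 0)
  off : ∀ e, e ∉ S → (0 < sg o e * z e ∧ sg o e * z e < N ∧ x e = 0) ∨
    (sg o e * z e = N ∧ sg o e * x e < 0)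

theorem IsStair.dual {N : ℝ} {S : Set E} {x z : E → ℝ} (h : M.IsStair w wd N S o x z) :
    M.dual.IsStair wd w N Sᶜ o z x :=
  ⟨h.z_mem, h.x_mem, h.off, fun e he => h.on e (not_not.1 he)⟩

/-- On `A` the basic solution has the sign opposite to `o` or is zero, so the shift by `N` brings it
into the range from 0 to `N`, endpoint `N` included; likewise for `z` on `B`. Membership in `T`, `A`
and `B` selects the segment of the staircase. -/
theorem IsGeo.isStair {N : ℝ} {T A B : Set E} {x z : E → ℝ}
    (h : M.IsGeo w wd T (flip o (A ∪ B)) x z) (hA : part o A ∈ M.flows)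
    (hB : part o B ∈ M.dual.flows) (hx : ∀ e, |x e| < N) (hz : ∀ e, |z e| < N) :
    M.IsStair w wd N ((T ∪ A) \ B) o (x + N • part o A) (z + N • part o B) := by
  refine ⟨?_, ?_, fun e he => ?_, fun e he => ?_⟩
  · rw [add_sub_right_comm]
    exact M.flows.add_mem h.x_mem (M.flows.smul_mem _ hA)
  · rw [add_sub_right_comm]
    exact M.dual.flows.add_mem h.z_mem (M.dual.flows.smul_mem _ hB)
  all_goals
    have h1 := abs_lt.1 (hx e)
    have h2 := abs_lt.1 (hz e)
    have h3 := h.on e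
    have h4 := h.off e
    have h5 := fun h : e ∈ A => notMem_of_part_mem hA hB h
    simp only [Pi.add_apply, Pi.smul_apply, smul_eq_mul]
    by_cases hA1 : e ∈ A
    · have hB1 := h5 hA1
      rw [sg_flip_of_mem (Set.mem_union_left _ hA1)] at h3 h4
      rw [part_of_mem hA1, part_of_notMem hB1]
      by_cases hT1 : e ∈ T
      · have := h3 hT1
        first
        | (exact absurd ⟨Or.inl hT1, hB1⟩ he)
        | (left
           rcases sg_eq o e with hs | hs <;> rw [hs] at this ⊢ <;>
             refine ⟨?_, ?_, ?_⟩ <;> linarith)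
      · have := h4 hT1
        first
        | (exact absurd ⟨Or.inr hA1, hB1⟩ he)
        | (right
           rcases sg_eq o e with hs | hs <;> rw [hs] at this ⊢ <;>
             refine ⟨?_, ?_⟩ <;> linarith)
    · by_cases hB1 : e ∈ B
      · rw [sg_flip_of_mem (Set.mem_union_right _ hB1)] at h3 h4
        rw [part_of_notMem hA1, part_of_mem hB1]
        by_cases hT1 : e ∈ T
        · have := h3 hT1
          first
          | (exact absurd hB1 he.2)
          | (right
             rcases sg_eq o e with hs | hs <;> rw [hs] at this ⊢ <;>
               refine ⟨?_, ?_⟩ <;> linarith)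
        · have := h4 hT1
          first
          | (exact absurd hB1 he.2)
          | (left
             rcases sg_eq o e with hs | hs <;> rw [hs] at this ⊢ <;>
               refine ⟨?_, ?_, ?_⟩ <;> linarith)
      · rw [sg_flip_of_notMem (by simp [hA1, hB1])] at h3 h4
        rw [part_of_notMem hA1, part_of_notMem hB1]
        by_cases hT1 : e ∈ T
        · have := h3 hT1
          first
          | (exact absurd ⟨Or.inl hT1, hB1⟩ he)
          | (left
             rcases sg_eq o e with hs | hs <;> rw [hs] at this ⊢ <;>
               refine ⟨?_, ?_, ?_⟩ <;> linarith)
        · have := h4 hT1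
          first
          | (exact absurd he.1 (by simp [hA1, hT1]))
          | (left
             rcases sg_eq o e with hs | hs <;> rw [hs] at this ⊢ <;>
               refine ⟨?_, ?_, ?_⟩ <;> linarith)

/-- For a fixed set the two signs trace one curve: a horizontal piece between `-N` and `N`,
descending at the right end and ascending at the left. It is weakly decreasing, even when the signs
differ. -/
theorem stair_mul_nonpos {N s s' x x' z z' : ℝ} (hN : 0 < N) (hs : s = 1 ∨ s = -1)
    (hs' : s' = 1 ∨ s' = -1) (h : (0 < s * x ∧ s * x < N ∧ z = 0) ∨ (s * x = N ∧ s * z < 0))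
    (h' : (0 < s' * x' ∧ s' * x' < N ∧ z' = 0) ∨ (s' * x' = N ∧ s' * z' < 0)) :
    (x - x') * (z - z') ≤ 0 := by
  rcases h with ⟨h1, h2, h3⟩ | ⟨h1, h2⟩ <;> rcases h' with ⟨h1', h2', h3'⟩ | ⟨h1', h2'⟩
  · simp [h3, h3']
  all_goals
    rcases hs with hs | hs <;> rcases hs' with hs' | hs' <;> subst hs hs' <;>
    first
    | exact mul_nonpos_of_nonpos_of_nonneg (by linarith) (by linarith)
    | exact mul_nonpos_of_nonneg_of_nonpos (by linarith) (by linarith)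
    | (have : x - x' = 0 := by linarith
       simp [this])

theorem stair_eq_zero {N s s' x x' z z' : ℝ} (hs : s = 1 ∨ s = -1)
    (hs' : s' = 1 ∨ s' = -1) (h : (0 < s * x ∧ s * x < N ∧ z = 0) ∨ (s * x = N ∧ s * z < 0))
    (h' : (0 < s' * x' ∧ s' * x' < N ∧ z' = 0) ∨ (s' * x' = N ∧ s' * z' < 0))
    (hx : x ≠ x') (hz : z = z') : z = 0 := by
  subst hz
  by_contra h0
  rcases h with ⟨h1, h2, h3⟩ | ⟨h1, h2⟩
  · exact h0 h3
  rcases h' with ⟨h1', h2', h3'⟩ | ⟨h1', h2'⟩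
  · exact h0 h3'
  rcases hs with hs | hs <;> rcases hs' with hs' | hs' <;> subst hs hs' <;>
    first | linarith | exact hx (by linarith)

theorem stair_eq_of_ne {N s s' x x' z z' : ℝ} (hs : s = 1 ∨ s = -1)
    (hs' : s' = 1 ∨ s' = -1) (h : (0 < s * x ∧ s * x < N ∧ z = 0) ∨ (s * x = N ∧ s * z < 0))
    (h' : (0 < s' * x' ∧ s' * x' < N ∧ z' = 0) ∨ (s' * x' = N ∧ s' * z' < 0))
    (hx : x = x') (hz : z ≠ z') : x = N ∨ x = -N := by
  subst hx
  rcases h with ⟨h1, h2, h3⟩ | ⟨h1, h2⟩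
  · rcases h' with ⟨h1', h2', h3'⟩ | ⟨h1', h2'⟩
    · exact absurd (h3.trans h3'.symm) hz
    · rcases hs' with hs' | hs' <;> subst hs'
      · left; linarith
      · right; linarith
  · rcases hs with hs | hs <;> subst hs
    · left; linarith
    · right; linarith

theorem IsStair.sub_mul_sub {N : ℝ} (hN : 0 < N) {S : Set E} {o' : E → ℤˣ} {x z x' z' : E → ℝ}
    (h : M.IsStair w wd N S o x z) (h' : M.IsStair w wd N S o' x' z') (e : E) :
    (x e - x' e) * (z e - z' e) = 0 := by
  have hx := M.flows.sub_mem h.x_mem h'.x_mem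
  have hz := M.dual.flows.sub_mem h.z_mem h'.z_mem
  rw [sub_sub_sub_cancel_right] at hx hz
  have hle : ∀ e ∈ Finset.univ, (x - x') e * (z - z') e ≤ 0 := by
    intro e _
    by_cases he : e ∈ S
    · exact stair_mul_nonpos hN (sg_eq o e) (sg_eq o' e) (h.on e he) (h'.on e he)
    · rw [mul_comm]
      exact stair_mul_nonpos hN (sg_eq o e) (sg_eq o' e) (h.off e he) (h'.off e he)
  exact (Finset.sum_eq_zero_iff_of_nonpos hle).1 (sum_mul_eq_zero hx hz) e (Finset.mem_univ _)

/-- Where `x` and `x'` differ the dual coordinates agree, and the staircase then forces them to be 0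
or `±N`. A circuit supported there pairs with `w` to a multiple of `N`, against genericity and the
bound on the pairing. -/
theorem IsStair.x_unique {N : ℝ} (hN : 0 < N) (hw : M.Generic w)
    (hwN : ∀ c ∈ M.circ, |ip c w| < N) {S : Set E} {o' : E → ℤˣ} {x z x' z' : E → ℝ}
    (h : M.IsStair w wd N S o x z) (h' : M.IsStair w wd N S o' x' z') : x = x' := by
  have hx := M.flows.sub_mem h.x_mem h'.x_mem
  rw [sub_sub_sub_cancel_right] at hx
  refine sub_eq_zero.1 ?_
  by_contra hne
  obtain ⟨e, he⟩ := Function.ne_iff.1 hne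
  obtain ⟨c, hc, -, hcf⟩ := exists_conformal hx he
  have hint : ∀ f, ∃ k : ℤ, (c f : ℝ) * z f = N * k := by
    intro f
    by_cases hf : c f = 0
    · exact ⟨0, by simp [hf]⟩
    have hxf : x f ≠ x' f := by
      intro heq
      simpa [heq] using hcf f hf
    have hzf : z f = z' f := by
      rcases mul_eq_zero.1 (h.sub_mul_sub hN h' f) with h0 | h0
      · exact absurd (sub_eq_zero.1 h0) hxf
      · exact sub_eq_zero.1 h0
    by_cases hfS : f ∈ S
    · refine ⟨0, ?_⟩
      simp [stair_eq_zero (sg_eq o f) (sg_eq o' f) (h.on f hfS) (h'.on f hfS) hxf hzf]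
    -- Off `S` the staircase is the transposed one, so a difference in `x` with equal `z` means that
    -- `z` is at an end of the horizontal piece.
    · rcases stair_eq_of_ne (sg_eq o f) (sg_eq o' f) (h.off f hfS) (h'.off f hfS) hzf hxf
        with h0 | h0
      · exact ⟨c f, by rw [h0]; ring⟩
      · exact ⟨-c f, by rw [h0]; push_cast; ring⟩
  choose k hk using hint
  have hsum : ip c w = N * ((∑ f, k f : ℤ) : ℝ) := by
    rw [← ip_eq_of_sub_mem h.z_mem hc, ip, Int.cast_sum, Finset.mul_sum]
    exact Finset.sum_congr rfl fun f _ => hk f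
  have hlt := hwN c hc
  have hne0 := hw c hc
  rw [hsum] at hlt hne0
  rw [abs_mul, abs_of_pos hN] at hlt
  have hk0 : (∑ f, k f) ≠ 0 := by
    intro h0
    simp [h0] at hne0
  have h1 : (1 : ℝ) ≤ |((∑ f, k f : ℤ) : ℝ)| := by
    have := Int.one_le_abs hk0
    exact_mod_cast this
  nlinarith

theorem IsStair.orientation_unique {N : ℝ} (hN : 0 < N) (hw : M.Generic w)
    (hwd : M.dual.Generic wd) (hwN : ∀ c ∈ M.circ, |ip c w| < N)
    (hwdN : ∀ d ∈ M.cocirc, |ip d wd| < N) {S : Set E} {o' : E → ℤˣ} {x z x' z' : E → ℝ}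
    (h : M.IsStair w wd N S o x z) (h' : M.IsStair w wd N S o' x' z') : o = o' := by
  have hx := h.x_unique hN hw hwN h'
  have hz := h.dual.x_unique hN hwd hwdN h'.dual
  subst hx hz
  funext e
  by_cases he : e ∈ S
  · refine sg_eq_of_pos (t := x e) ?_ ?_
    · rcases h.on e he with h1 | h1 <;> linarith [h1.1]
    · rcases h'.on e he with h1 | h1 <;> linarith [h1.1]
  · refine sg_eq_of_pos (t := z e) ?_ ?_
    · rcases h.off e he with h1 | h1 <;> linarith [h1.1]
    · rcases h'.off e he with h1 | h1 <;> linarith [h1.1]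

/-- Trees matched with reversals of two orientations give distinct sets for distinct
orientations. -/
theorem orientation_eq_of_set_eq (hw : M.Generic w) (hwd : M.dual.Generic wd) {o' : E → ℤˣ}
    {T A B T' A' B' : Set E} {x z x' z' : E → ℝ}
    (h : M.IsGeo w wd T (flip o (A ∪ B)) x z) (hA : part o A ∈ M.flows)
    (hB : part o B ∈ M.dual.flows)
    (h' : M.IsGeo w wd T' (flip o' (A' ∪ B')) x' z') (hA' : part o' A' ∈ M.flows)
    (hB' : part o' B' ∈ M.dual.flows) (hS : (T ∪ A) \ B = (T' ∪ A') \ B') : o = o' := by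
  let n : (E → ℝ) → ℝ := fun y => ∑ e, |y e|
  have hn0 : ∀ y, 0 ≤ n y := fun y => Finset.sum_nonneg fun e _ => abs_nonneg _
  have hn : ∀ y e, |y e| ≤ n y := fun y e =>
    Finset.single_le_sum (f := fun e => |y e|) (fun e _ => abs_nonneg _) (Finset.mem_univ e)
  -- The sum of absolute values bounds every coordinate and every pairing with a circuit or
  -- cocircuit, so this `N` exceeds all quantities involved.
  let N := 1 + n w + n wd + n x + n z + n x' + n z'
  have hN : N = 1 + n w + n wd + n x + n z + n x' + n z' := rfl
  have h0 := hn0 w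
  have h1 := hn0 wd
  have h2 := hn0 x
  have h3 := hn0 z
  have h4 := hn0 x'
  have h5 := hn0 z'
  have s := h.isStair (N := N) hA hB (fun e => by linarith [hn x e]) fun e => by linarith [hn z e]
  have s' := h'.isStair (N := N) hA' hB' (fun e => by linarith [hn x' e])
    fun e => by linarith [hn z' e]
  rw [← hS] at s'
  refine s.orientation_unique (N := N) (by linarith) hw hwd (fun c hc => ?_) (fun d hd => ?_) s'
  · have : |ip c w| ≤ n w := abs_ip_le (M.circ_val c hc) w
    linarith
  · have : |ip d wd| ≤ n wd := abs_ip_le (M.cocirc_val d hd) wd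
    linarith

end Digraphoid

/-! ### Acyclic signatures as weights, fundamental circuits, disjoint families -/

namespace Digraphoid

variable {E : Type*} [Fintype E] {M : Digraphoid E} {w wd : E → ℝ} {o : E → ℤˣ}

theorem ip_eq_apply (f : (E → ℝ) →L[ℝ] ℝ) [DecidableEq E] (c : E → ℤ) :
    ip c (fun e => f (Pi.single e 1)) = f (toReal c) := by
  have h : toReal c = ∑ e, (c e : ℝ) • (Pi.single e 1 : E → ℝ) := by
    funext e
    simp [toReal, Finset.sum_apply, Pi.single_apply]
  rw [h, map_sum]
  simp [ip]

/-- Gordan's theorem. -/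
theorem exists_ip_pos {ι : Type*} [Finite ι] (dir : ι → E → ℤ)
    (h : ∀ a : ι → ℝ, (∀ i, 0 ≤ a i) → (∀ e, ∑ᶠ i, a i * (dir i e : ℝ) = 0) → ∀ i, a i = 0) :
    ∃ w : E → ℝ, ∀ i, 0 < ip (dir i) w := by
  classical
  have := Fintype.ofFinite ι
  let L : (ι → ℝ) →ₗ[ℝ] (E → ℝ) := Fintype.linearCombination ℝ (fun i => toReal (dir i))
  have hL : ∀ a, L a = ∑ i, a i • toReal (dir i) := fun a =>
    Fintype.linearCombination_apply ℝ _ a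
  have hconv : Convex ℝ (L '' stdSimplex ℝ ι) := (convex_stdSimplex ℝ ι).linear_image L
  have hcomp : IsCompact (L '' stdSimplex ℝ ι) :=
    (isCompact_stdSimplex ℝ ι).image L.continuous_of_finiteDimensional
  -- Acyclicity says that 0 is not a convex combination of the directions; a functional separating 0
  -- from this compact convex set is the weight.
  have h0 : (0 : E → ℝ) ∉ L '' stdSimplex ℝ ι := by
    rintro ⟨a, ⟨ha, hsum⟩, ha0⟩
    have := h a ha fun e => by
      rw [finsum_eq_sum_of_fintype]
      have := congrFun ha0 e
      rw [hL] at this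
      simpa [toReal] using this
    simp [this] at hsum
  obtain ⟨f, u, hu, hf⟩ := geometric_hahn_banach_point_closed hconv hcomp.isClosed h0
  refine ⟨fun e => f (Pi.single e 1), fun i => ?_⟩
  rw [ip_eq_apply]
  rw [map_zero] at hu
  refine hu.trans (hf _ ⟨Pi.single i 1, single_mem_stdSimplex ℝ i, ?_⟩)
  rw [hL, Finset.sum_eq_single i] <;> simp +contextual

/-- An acyclic choice of directions of the circuits is given by a generic weight. -/
theorem exists_weight {ι : Type*} [Finite ι] (dir : ι → E → ℤ)
    (hall : ∀ c ∈ M.circ, ∃ i, c = dir i ∨ c = -dir i)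
    (h : ∀ a : ι → ℝ, (∀ i, 0 ≤ a i) → (∀ e, ∑ᶠ i, a i * (dir i e : ℝ) = 0) → ∀ i, a i = 0) :
    ∃ w : E → ℝ, M.Generic w ∧ (∀ i, 0 < ip (dir i) w) ∧
      ∀ o, (∀ c, c ∈ M.circ → Conforms c o → ∃ i, dir i = c) ↔ M.Compat w o := by
  obtain ⟨w, hw⟩ := exists_ip_pos dir h
  refine ⟨w, fun c hc => ?_, hw, fun o => ⟨fun ho c hc hco => ?_, fun ho c hc hco => ?_⟩⟩
  · obtain ⟨i, rfl | rfl⟩ := hall c hc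
    · exact (hw i).ne'
    · rw [ip_neg]
      exact neg_ne_zero.2 (hw i).ne'
  · obtain ⟨i, rfl⟩ := ho c hc hco
    exact hw i
  · obtain ⟨i, rfl | rfl⟩ := hall c hc
    · exact ⟨i, rfl⟩
    · have h1 := ho _ hc hco
      rw [ip_neg] at h1
      linarith [hw i]

/-- Since `z` vanishes on `T`, the pairing of `c` with `w` is the single term `c e * z e`. -/
theorem IsGeo.eq_sign {T : Set E} {x z : E → ℝ} (h : M.IsGeo w wd T o x z) {e : E} (he : e ∉ T)
    {c : E → ℤ} (hc : c ∈ M.circ) (hcT : ∀ f, f ≠ e → c f ≠ 0 → f ∈ T) (hpos : 0 < ip c w) :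
    (o e : ℤ) = c e := by
  rw [← ip_eq_of_sub_mem h.z_mem hc, ip_eq_single fun f hf hcf => (h.on f (hcT f hf hcf)).2]
    at hpos
  have h1 := (h.off e he).2
  unfold sg at h1
  rcases M.circ_val c hc e with h2 | h2 | h2 <;> rcases Int.units_eq_one_or (o e) with h3 | h3 <;>
    rw [h2] at hpos ⊢ <;> rw [h3] at h1 ⊢ <;> push_cast at hpos h1 ⊢ <;> first | rfl | linarith

/-- After scaling by a sign to agree at `e`, the two circuits differ by a flow supported in `T`,
which is zero. -/
theorem IsBasis.support_unique {T : Set E} (hT : M.IsBasis T) {e : E} {c c' : E → ℤ}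
    (hc : c ∈ M.circ) (hc' : c' ∈ M.circ) (hcT : Function.support c ⊆ T ∪ {e})
    (hcT' : Function.support c' ⊆ T ∪ {e}) : Function.support c = Function.support c' := by
  have hne : ∀ {c : E → ℤ}, c ∈ M.circ → Function.support c ⊆ T ∪ {e} → c e ≠ 0 := by
    intro c hc hcT h0
    obtain ⟨f, hf, hcf⟩ := hT.circ c hc
    rcases hcT hcf with h | h
    · exact hf h
    · rw [Set.mem_singleton_iff] at h
      exact hcf (h ▸ h0)
  have hs := sq_eq_one_of_ne hc' (hne hc' hcT')
  have hs' := sq_eq_one_of_ne hc (hne hc hcT)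
  have hx : toReal c - ((c e : ℝ) * c' e) • toReal c' = 0 := by
    refine flow_eq_zero (M.flows.sub_mem (toReal_mem_flows hc)
      (M.flows.smul_mem _ (toReal_mem_flows hc'))) fun b hb => ?_
    obtain ⟨f, hf, hbf⟩ := hT.circ b hb
    refine ⟨f, hbf, ?_⟩
    simp only [toReal, Pi.sub_apply, Pi.smul_apply, smul_eq_mul]
    by_cases hfe : f = e
    · subst hfe
      linear_combination (-(c f : ℝ)) * hs
    · have h1 : c f = 0 := by
        by_contra h
        exact (hcT h).elim hf hfe
      have h2 : c' f = 0 := by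
        by_contra h
        exact (hcT' h).elim hf hfe
      simp [h1, h2]
  have hce : (c e : ℝ) ≠ 0 := by
    intro h; simp [h] at hs'
  have hce' : (c' e : ℝ) ≠ 0 := by
    intro h; simp [h] at hs
  ext f
  have hf := congrFun hx f
  simp only [toReal, Pi.sub_apply, Pi.smul_apply, smul_eq_mul, Pi.zero_apply] at hf
  simp only [Function.mem_support]
  refine not_congr ⟨fun h => ?_, fun h => ?_⟩
  · rw [h] at hf
    simpa [hce, hce'] using hf
  · rw [h] at hf
    simpa using hf

theorem part_iUnion_mem {𝒞 : Set (E → ℤ)} (h : ∀ c ∈ 𝒞, c ∈ M.circ ∧ Conforms c o)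
    (hd : 𝒞.PairwiseDisjoint Function.support) :
    part o (⋃ c ∈ 𝒞, Function.support c) ∈ M.flows := by
  classical
  -- A vector conforming to `o` is determined by its support.
  have hfin : 𝒞.Finite := by
    refine Set.Finite.of_injOn (f := Function.support) (t := Set.univ)
      (fun _ _ => Set.mem_univ _) (fun c hc c' hc' hcc => ?_) Set.finite_univ
    funext e
    by_cases he : c e = 0
    · have : e ∉ Function.support c' := by rw [← hcc]; simpa using he
      simp only [Function.mem_support, not_not] at this
      rw [he, this]
    · have : c' e ≠ 0 := by
        change e ∈ Function.support c'
        rw [← hcc]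
        exact he
      rw [(h c hc).2 e he, (h c' hc').2 e this]
  have hsum : part o (⋃ c ∈ 𝒞, Function.support c) = ∑ c ∈ hfin.toFinset, toReal c := by
    funext e
    rw [Finset.sum_apply]
    by_cases he : e ∈ ⋃ c ∈ 𝒞, Function.support c
    · rw [part_of_mem he]
      simp only [Set.mem_iUnion] at he
      obtain ⟨c, hc, hce⟩ := he
      rw [Finset.sum_eq_single c]
      · exact (sg_mul_intCast ((h c hc).2 e hce)).symm
      · intro c' hc' hne
        have hdis := hd (hfin.mem_toFinset.1 hc') hc hne
        have : e ∉ Function.support c' := fun h' => Set.disjoint_left.1 hdis h' hce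
        simp only [Function.mem_support, not_not] at this
        simp [toReal, this]
      · intro h'
        exact absurd (hfin.mem_toFinset.2 hc) h'
    · rw [part_of_notMem he]
      symm
      refine Finset.sum_eq_zero fun c hc => ?_
      simp only [Set.mem_iUnion, not_exists, Function.mem_support, not_not] at he
      simp [toReal, he c (hfin.mem_toFinset.1 hc)]
  rw [hsum]
  exact Submodule.sum_mem _ fun c hc => toReal_mem_flows (h c (hfin.mem_toFinset.1 hc)).1

theorem exists_circ_of_part_mem {A : Set E} (hA : part o A ∈ M.flows) {e : E} (he : e ∈ A) :
    ∃ c ∈ M.circ, c e ≠ 0 ∧ Conforms c o ∧ Function.support c ⊆ A := by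
  have hne : part o A e ≠ 0 := by
    rw [part_of_mem he]
    rcases sg_eq o e with h | h <;> simp [h]
  obtain ⟨c, hc, hce, hcf⟩ := exists_conformal hA hne
  have hsub : Function.support c ⊆ A := by
    intro f hf
    by_contra hfA
    simpa [part_of_notMem hfA] using hcf f hf
  refine ⟨c, hc, hce, fun f hf => ?_, hsub⟩
  have h1 := hcf f hf
  rw [part_of_mem (hsub hf)] at h1
  unfold sg at h1
  rcases M.circ_val c hc f with h2 | h2 | h2 <;> rcases Int.units_eq_one_or (o f) with h3 | h3 <;>
    simp [h2, h3] at h1 ⊢ <;> linarith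

/-- Remove conforming circuits from `A` one at a time; what is left is again the support of a flow
with the signs of `o`. -/
theorem exists_family {A : Set E} (hA : part o A ∈ M.flows) :
    ∃ 𝒞 : Set (E → ℤ), (∀ c ∈ 𝒞, c ∈ M.circ ∧ Conforms c o) ∧
      𝒞.PairwiseDisjoint Function.support ∧ ⋃ c ∈ 𝒞, Function.support c = A := by
  induction hn : A.ncard using Nat.strong_induction_on generalizing A with
  | _ n ih =>
    rcases A.eq_empty_or_nonempty with rfl | ⟨e, he⟩
    · exact ⟨∅, by simp, by simp, by simp⟩
    obtain ⟨c, hc, hce, hco, hcA⟩ := exists_circ_of_part_mem hA he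
    have hdiff : part o (A \ Function.support c) = part o A - toReal c := by
      funext f
      simp only [Pi.sub_apply, toReal]
      by_cases hf : c f = 0
      · by_cases hfA : f ∈ A
        · rw [part_of_mem hfA, part_of_mem (by simp [hfA, hf]), hf]; simp
        · rw [part_of_notMem hfA, part_of_notMem fun h => hfA h.1, hf]; simp
      · rw [part_of_mem (hcA hf), part_of_notMem fun h => h.2 hf, sg_mul_intCast (hco f hf)]
        simp
    have hlt : (A \ Function.support c).ncard < n := by
      rw [← hn]
      exact Set.ncard_lt_ncard ⟨Set.sdiff_subset, fun h => (h he).2 hce⟩ (Set.toFinite _)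
    obtain ⟨𝒞, h1, h2, h3⟩ := ih _ hlt
      (hdiff ▸ M.flows.sub_mem hA (toReal_mem_flows hc)) rfl
    refine ⟨insert c 𝒞, ?_, ?_, ?_⟩
    · rintro c' (rfl | hc')
      · exact ⟨hc, hco⟩
      · exact h1 c' hc'
    · refine h2.insert fun c' hc' _ => Set.disjoint_left.2 fun f hf hf' => ?_
      have : f ∈ ⋃ c ∈ 𝒞, Function.support c := Set.mem_biUnion hc' hf'
      rw [h3] at this
      exact this.2 hf
    · rw [Set.biUnion_insert, h3, Set.union_sdiff_cancel hcA]

/-- One direction compares `A`, `B` with the empty reversal and uses uniqueness. In the other, a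
conforming circuit avoids `B` by orthogonality and so survives the reversal. -/
theorem compat_iff_eq_empty {A B : Set E} (hA : part o A ∈ M.flows)
    (hB : part o B ∈ M.dual.flows) (h : M.Compat w (flip o (A ∪ B))) :
    M.Compat w o ↔ A = ∅ := by
  have hpart : part o ∅ = 0 := Set.indicator_empty _
  have hflip : flip o (∅ ∪ ∅) = o := by
    funext e
    exact flip_of_notMem (by simp)
  constructor
  · intro ho
    refine eq_of_compat_flip (w := w) hA hB (hpart ▸ M.flows.zero_mem)
      (hpart ▸ M.dual.flows.zero_mem) h ?_
    rwa [hflip]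
  · rintro rfl c hc hco
    refine h c hc fun e he => ?_
    rw [flip_of_notMem]
    · exact hco e he
    rintro (h' | h')
    · exact h'
    have hle : ∀ e ∈ Finset.univ, 0 ≤ (c e : ℝ) * part o B e := by
      intro e _
      by_cases h1 : c e = 0
      · simp [h1]
      by_cases h2 : e ∈ B
      · rw [sg_mul_intCast (hco e h1), part_of_mem h2, sg_mul_self]
        exact zero_le_one
      · simp [part_of_notMem h2]
    have := (Finset.sum_eq_zero_iff_of_nonneg hle).1 (hB c hc) e (Finset.mem_univ _)
    rw [sg_mul_intCast (hco e he), part_of_mem h', sg_mul_self] at this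
    exact one_ne_zero this

theorem no_circ_iff_eq_empty {A B T : Set E} (hA : part o A ∈ M.flows)
    (hB : part o B ∈ M.dual.flows) (hT : M.IsBasis T) :
    (∀ c ∈ M.circ, ∃ f, f ∉ (T ∪ A) \ B ∧ c f ≠ 0) ↔ A = ∅ := by
  constructor
  · intro h
    refine Set.eq_empty_iff_forall_notMem.2 fun e he => ?_
    obtain ⟨c, hc, -, -, hcA⟩ := exists_circ_of_part_mem hA he
    obtain ⟨f, hf, hcf⟩ := h c hc
    exact hf ⟨Or.inr (hcA hcf), notMem_of_part_mem hA hB (hcA hcf)⟩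
  · rintro rfl c hc
    obtain ⟨f, hf, hcf⟩ := hT.circ c hc
    exact ⟨f, fun h => by simp [hf] at h, hcf⟩

end Digraphoid

/-! ### Directed cycles and cocycles of a connected graph form a digraphoid -/

theorem Relation.ReflTransGen.exists_injOn {V : Type*} {r : V → V → Prop} {a b : V}
    (h : Relation.ReflTransGen r a b) :
    ∃ (n : ℕ) (v : ℕ → V), v 0 = a ∧ v n = b ∧ (∀ i < n, r (v i) (v (i + 1))) ∧
      ∀ i ≤ n, ∀ j ≤ n, v i = v j → i = j := by
  classical
  have hex : ∃ (n : ℕ) (v : ℕ → V), v 0 = a ∧ v n = b ∧ ∀ i < n, r (v i) (v (i + 1)) := by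
    induction h with
    | refl => exact ⟨0, fun _ => a, rfl, rfl, by simp⟩
    | @tail b c _ hbc ih =>
      obtain ⟨n, v, h0, hn, hr⟩ := ih
      refine ⟨n + 1, fun i => if i ≤ n then v i else c, by simp [h0], by simp, fun i hi => ?_⟩
      rcases (Nat.lt_succ_iff.1 hi).lt_or_eq with h | rfl
      · simpa [h.le, Nat.succ_le_of_lt h] using hr i h
      · simpa [hn] using hbc
  obtain ⟨v, h0, hn, hr⟩ := Nat.find_spec hex
  set n := Nat.find hex with hndef
  have key : ∀ i j, i < j → j ≤ n → v i ≠ v j := by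
    intro i j hij hj heq
    -- A shortest walk has no repeated vertex: cutting out the part between the two visits would
    -- shorten it.
    refine Nat.find_min hex (m := n - (j - i)) (by omega)
      ⟨fun k => if k ≤ i then v k else v (k + (j - i)), by simp [h0], ?_, fun k hk => ?_⟩
    · by_cases h : n - (j - i) ≤ i
      · have h1 : n = j := by omega
        have h2 : n - (j - i) = i := by omega
        simp only [h2, le_refl, if_true]
        rw [heq, ← h1, hn]
      · simp only [h, if_false]
        rw [Nat.sub_add_cancel (by omega), hn]
    · rcases lt_trichotomy k i with h | h | h
      · simpa [h.le, Nat.succ_le_of_lt h] using hr k (by omega)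
      · subst h
        have h3 : k + 1 + (j - k) = j + 1 := by omega
        simp only [le_refl, if_true, show ¬ (k + 1 ≤ k) by omega, if_false, h3]
        rw [heq]
        exact hr j (by omega)
      · simp only [show ¬ k ≤ i by omega, show ¬ k + 1 ≤ i by omega, if_false]
        have := hr (k + (j - i)) (by omega)
        rwa [show k + (j - i) + 1 = k + 1 + (j - i) by omega] at this
  refine ⟨n, v, h0, hn, hr, fun i hi j hj hij => ?_⟩
  rcases lt_trichotomy i j with h | h | h
  · exact absurd hij (key i j h hj)
  · exact h
  · exact absurd hij.symm (key j i h hi)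

namespace Graph

variable {α β : Type*} {G : Graph α β}

theorem mem_iff_of_notMem_cut {K : Set V(G)} {f : E(G)} {u v : V(G)} (h : G.IsLink f u v)
    (hf : f ∉ G.cut K) : u ∈ K ↔ v ∈ K := by
  constructor <;> intro h1 <;> by_contra h2
  · exact hf ⟨u, v, h1, h2, h⟩
  · exact hf ⟨v, u, h1, h2, h.symm⟩

theorem mem_iff_notMem_of_mem_cut {K : Set V(G)} {f : E(G)} {u v : V(G)} (h : G.IsLink f u v)
    (hf : f ∈ G.cut K) : u ∈ K ↔ v ∉ K := by
  obtain ⟨a, b, ha, hb, hab⟩ := hf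
  rcases hab.eq_and_eq_or_eq_and_eq h with ⟨h1, h2⟩ | ⟨h1, h2⟩
  · obtain rfl := Subtype.ext h1
    obtain rfl := Subtype.ext h2
    simp [ha, hb]
  · obtain rfl := Subtype.ext h1
    obtain rfl := Subtype.ext h2
    simp [ha, hb]

namespace RefOrientation

variable (R : G.RefOrientation)

open Classical in
/-- The directed cut of `W`, as a vector. -/
noncomputable def delta (W : Set V(G)) (e : E(G)) : ℤ :=
  (if R.tail e ∈ W then 1 else 0) - (if R.head e ∈ W then 1 else 0)

variable {R}

theorem delta_ne_zero_iff {W : Set V(G)} {e : E(G)} : R.delta W e ≠ 0 ↔ e ∈ G.cut W := by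
  constructor
  · intro h
    by_contra he
    have := mem_iff_of_notMem_cut (R.isLink e) he
    by_cases h1 : R.head e ∈ W <;> simp [delta, this, h1] at h
  · intro he
    have := mem_iff_notMem_of_mem_cut (R.isLink e) he
    by_cases h1 : R.head e ∈ W <;> simp [delta, this, h1]

theorem support_delta (W : Set V(G)) : Function.support (R.delta W) = G.cut W :=
  Set.ext fun _ => delta_ne_zero_iff

theorem delta_compl (W : Set V(G)) : R.delta Wᶜ = -R.delta W := by
  funext e
  by_cases h1 : R.head e ∈ W <;> by_cases h2 : R.tail e ∈ W <;> simp [delta, h1, h2]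

theorem delta_val (W : Set V(G)) (e : E(G)) :
    R.delta W e = 0 ∨ R.delta W e = 1 ∨ R.delta W e = -1 := by
  by_cases h1 : R.head e ∈ W <;> by_cases h2 : R.tail e ∈ W <;> simp [delta, h1, h2]

open Classical in
theorem IsArc.mul_delta {e : E(G)} {s : ℤ} {u w : V(G)} (h : R.IsArc e s u w) (W : Set V(G)) :
    s * R.delta W e = (if u ∈ W then 1 else 0) - (if w ∈ W then 1 else 0) := by
  rcases h with ⟨rfl, rfl, rfl⟩ | ⟨rfl, rfl, rfl⟩ <;> simp [delta]

theorem IsArc.sign {e : E(G)} {s : ℤ} {u w : V(G)} (h : R.IsArc e s u w) : s = 1 ∨ s = -1 := by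
  rcases h with ⟨rfl, -⟩ | ⟨rfl, -⟩ <;> simp

theorem IsArc.neg {e : E(G)} {s : ℤ} {u w : V(G)} (h : R.IsArc e s u w) : R.IsArc e (-s) w u := by
  rcases h with ⟨rfl, rfl, rfl⟩ | ⟨rfl, rfl, rfl⟩
  · exact Or.inr ⟨rfl, rfl, rfl⟩
  · exact Or.inl ⟨by simp, rfl, rfl⟩

theorem IsArc.isLink {e : E(G)} {s : ℤ} {u w : V(G)} (h : R.IsArc e s u w) : G.IsLink e u w := by
  rcases h with ⟨rfl, rfl, rfl⟩ | ⟨rfl, rfl, rfl⟩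
  · exact R.isLink e
  · exact (R.isLink e).symm

theorem isDirectedCocycle_iff {d : E(G) → ℤ} :
    R.IsDirectedCocycle d ↔ ∃ W, G.IsCocycle (G.cut W) ∧ d = R.delta W := by
  constructor
  · rintro ⟨hd, W, hW, h⟩
    refine ⟨W, hW ▸ hd, ?_⟩
    funext e
    by_cases he : d e = 0
    · have : e ∉ G.cut W := by rw [← hW]; simpa using he
      rw [he]
      by_contra h0
      exact this (delta_ne_zero_iff.1 (Ne.symm h0))
    · obtain ⟨u, w, hu, hw, harc⟩ := h e he
      have := harc.mul_delta W
      rw [if_pos hu, if_neg hw, sub_zero] at this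
      rcases harc.sign with h1 | h1 <;> rw [h1] at this ⊢ <;> linarith
  · rintro ⟨W, hW, rfl⟩
    refine ⟨by rwa [support_delta], W, support_delta W, fun e he => ?_⟩
    have := mem_iff_notMem_of_mem_cut (R.isLink e) (delta_ne_zero_iff.1 he)
    by_cases h1 : R.head e ∈ W
    · have h2 : R.tail e ∉ W := fun h => this.1 h h1
      exact ⟨_, _, h1, h2, Or.inr ⟨by simp [delta, h1, h2], rfl, rfl⟩⟩
    · have h2 := this.2 h1
      exact ⟨_, _, h2, h1, Or.inl ⟨by simp [delta, h1, h2], rfl, rfl⟩⟩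

theorem IsDirectedCycle.val {c : E(G) → ℤ} (h : R.IsDirectedCycle c) (e : E(G)) :
    c e = 0 ∨ c e = 1 ∨ c e = -1 := by
  obtain ⟨n, v, f, -, -, hs, harc⟩ := h
  by_cases he : c e = 0
  · exact Or.inl he
  · have : e ∈ Set.range f := hs ▸ he
    obtain ⟨i, rfl⟩ := this
    exact Or.inr (harc i).sign

theorem IsDirectedCycle.neg {c : E(G) → ℤ} (h : R.IsDirectedCycle c) : R.IsDirectedCycle (-c) := by
  obtain ⟨n, v, f, hv, hf, hs, harc⟩ := h
  -- In the reversed closed walk the edge from `v (-i)` to `v (-i - 1)` is the one of index `-i -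
  -- 1`.
  refine ⟨n, fun i => v (-i), fun i => f (-i - 1), fun i j hij => neg_injective (hv hij),
    fun i j hij => ?_, ?_, fun i => ?_⟩
  · have := hf hij
    simpa using this
  · rw [Function.support_neg, ← hs]
    ext e
    constructor
    · rintro ⟨i, rfl⟩
      exact ⟨_, rfl⟩
    · rintro ⟨i, rfl⟩
      exact ⟨-i - 1, by simp⟩
  · have := (harc (-i - 1)).neg
    rw [sub_add_cancel] at this
    have h2 : -(i + 1) = -i - 1 := by rw [neg_add, sub_eq_add_neg]
    simpa [h2] using this

theorem IsDirectedCycle.sum_mul_delta [Fintype E(G)] {c : E(G) → ℤ} (h : R.IsDirectedCycle c)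
    (W : Set V(G)) : ∑ e, c e * R.delta W e = 0 := by
  classical
  obtain ⟨n, v, f, hv, hf, hs, harc⟩ := h
  rw [← Fintype.sum_of_injective f hf (fun i => c (f i) * R.delta W (f i)) _ ?_ fun i => rfl]
  · simp only [(harc _).mul_delta W, Finset.sum_sub_distrib]
    rw [sub_eq_zero]
    exact (Equiv.sum_comp (Equiv.addRight (1 : Fin (n + 1)))
      (fun i => if v i ∈ W then (1 : ℤ) else 0)).symm
  · intro e he
    rw [hs, Function.mem_support, not_not] at he
    simp [he]

theorem IsDirectedCycle.nonzero {c : E(G) → ℤ} (h : R.IsDirectedCycle c) : ∃ e, c e ≠ 0 := by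
  obtain ⟨n, v, f, -, -, hs, -⟩ := h
  refine ⟨f 0, ?_⟩
  change f 0 ∈ Function.support c
  rw [← hs]
  exact ⟨0, rfl⟩

/-- Orthogonality to the star of each vertex on the cycle makes the ratio of `c'` to `c` the same on
consecutive edges, hence constant. -/
theorem IsDirectedCycle.eq_or_eq_neg [Fintype E(G)] {c c' : E(G) → ℤ} (h : R.IsDirectedCycle c)
    (h' : R.IsDirectedCycle c') (hsub : Function.support c' ⊆ Function.support c) :
    c' = c ∨ c' = -c := by
  classical
  obtain ⟨n, v, f, hv, hf, hs, harc⟩ := h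
  have hsq : ∀ i, c (f i) * c (f i) = 1 := fun i => by
    rcases (harc i).sign with h1 | h1 <;> simp [h1]
  have hstep : ∀ i, c' (f (i + 1)) * c (f (i + 1)) = c' (f i) * c (f i) := by
    intro i
    have hsum := h'.sum_mul_delta {v (i + 1)}
    rw [← Fintype.sum_of_injective f hf
      (fun j => c' (f j) * R.delta {v (i + 1)} (f j)) _ ?_ fun i => rfl] at hsum
    · have hterm : ∀ j, c' (f j) * R.delta {v (i + 1)} (f j) =
          (if j = i + 1 then c' (f j) * c (f j) else 0) -
            (if j = i then c' (f j) * c (f j) else 0) := by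
        intro j
        have h1 := (harc j).mul_delta {v (i + 1)}
        have h2 : R.delta {v (i + 1)} (f j) = c (f j) * ((if j = i + 1 then 1 else 0) -
            (if j = i then 1 else 0)) := by
          simp only [Set.mem_singleton_iff, hv.eq_iff, add_left_inj] at h1
          linear_combination c (f j) * h1 - R.delta {v (i + 1)} (f j) * hsq j
        rw [h2]
        split_ifs <;> ring
      simp only [hterm, Finset.sum_sub_distrib, Finset.sum_ite_eq', Finset.mem_univ, if_true]
        at hsum
      linarith
    · intro e he
      rw [hs, Function.mem_support, not_not] at he
      have : c' e = 0 := by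
        by_contra h0
        exact hsub h0 he
      simp [this]
  have hconst : ∀ i, c' (f i) * c (f i) = c' (f 0) * c (f 0) := by
    intro i
    induction i using Fin.induction with
    | zero => rfl
    | succ i ih => rw [← ih, ← hstep i.castSucc, Fin.coeSucc_eq_succ]
  have hval : ∀ i, c' (f i) = c' (f 0) * c (f 0) * c (f i) := fun i => by
    linear_combination c (f i) * hconst i - c' (f i) * hsq i
  have hout : ∀ e, e ∉ Set.range f → c e = 0 ∧ c' e = 0 := by
    intro e he
    rw [hs, Function.mem_support, not_not] at he
    refine ⟨he, ?_⟩
    by_contra h0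
    exact hsub h0 he
  have hc0 := (harc 0).sign
  have hr : c' (f 0) * c (f 0) = 0 ∨ c' (f 0) * c (f 0) = 1 ∨ c' (f 0) * c (f 0) = -1 := by
    rcases h'.val (f 0) with h1 | h1 | h1 <;> rcases hc0 with h2 | h2 <;> simp [h1, h2]
  rcases hr with hr | hr | hr
  · exfalso
    obtain ⟨e, he⟩ := h'.nonzero
    by_cases hef : e ∈ Set.range f
    · obtain ⟨i, rfl⟩ := hef
      exact he (by rw [hval, hr, zero_mul])
    · exact he (hout e hef).2
  · left
    funext e
    by_cases hef : e ∈ Set.range f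
    · obtain ⟨i, rfl⟩ := hef
      rw [hval, hr, one_mul]
    · rw [(hout e hef).1, (hout e hef).2]
  · right
    funext e
    by_cases hef : e ∈ Set.range f
    · obtain ⟨i, rfl⟩ := hef
      rw [hval, hr, neg_one_mul, Pi.neg_apply]
    · rw [Pi.neg_apply, (hout e hef).1, (hout e hef).2, neg_zero]

/-- A step along an arc of a partial orientation which avoids `e`: the edges in `P` may be
traversed forwards, those in `N` backwards. -/
def Step (R : G.RefOrientation) (P N : Set E(G)) (e : E(G)) (u v : V(G)) : Prop :=
  ∃ (f : E(G)) (s : ℤ), f ≠ e ∧ (s = 1 → f ∈ P) ∧ (s = -1 → f ∈ N) ∧ R.IsArc f s u v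

/-- A path from the head of `e` to its tail is closed up by `e`, which is placed at the last index.
-/
theorem exists_directedCycle {P N : Set E(G)} {e : E(G)}
    (h : Relation.ReflTransGen (R.Step P N e) (R.head e) (R.tail e)) :
    ∃ c, R.IsDirectedCycle c ∧ c e = 1 ∧ ∀ f, f ≠ e → (c f = 1 → f ∈ P) ∧ (c f = -1 → f ∈ N) := by
  classical
  obtain ⟨n, v, h0, hn, hr, hinj⟩ := h.exists_injOn
  have hr' : ∀ i, ∃ (f : E(G)) (s : ℤ), i < n → f ≠ e ∧ (s = 1 → f ∈ P) ∧ (s = -1 → f ∈ N) ∧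
      R.IsArc f s (v i) (v (i + 1)) := by
    intro i
    by_cases hi : i < n
    · obtain ⟨f, s, hfs⟩ := hr i hi
      exact ⟨f, s, fun _ => hfs⟩
    -- Dummy values beyond the end of the path.
    · exact ⟨e, 1, fun h => absurd h hi⟩
  choose f s hfs using hr'
  let edge : Fin (n + 1) → E(G) := fun i => if (i : ℕ) < n then f i else e
  let sgn : Fin (n + 1) → ℤ := fun i => if (i : ℕ) < n then s i else 1
  have harc : ∀ i : Fin (n + 1),
      R.IsArc (edge i) (sgn i) (v (i : ℕ)) (v ((i + 1 : Fin (n + 1)) : ℕ)) := by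
    intro i
    by_cases hi : (i : ℕ) < n
    · have h1 : ((i + 1 : Fin (n + 1)) : ℕ) = i + 1 := Fin.val_add_one_of_lt hi
      simp only [edge, sgn, hi, if_true, h1]
      exact (hfs i hi).2.2.2
    · have h2 : i = Fin.last n := Fin.ext (by have := i.2; simp only [Fin.val_last]; omega)
      subst h2
      simp only [edge, sgn, Fin.val_last, lt_irrefl, if_false, Fin.last_add_one, Fin.val_zero]
      exact Or.inl ⟨rfl, hn.symm, h0.symm⟩
  have hedge : Function.Injective edge := by
    intro i j hij
    have hi2 := i.2
    have hj2 := j.2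
    by_cases hi : (i : ℕ) < n <;> by_cases hj : (j : ℕ) < n <;>
      simp only [edge, hi, hj, if_true, if_false] at hij
    · have h1 := (hfs i hi).2.2.2.isLink
      have h2 := (hfs j hj).2.2.2.isLink
      rw [hij] at h1
      rcases h1.eq_and_eq_or_eq_and_eq h2 with ⟨h3, -⟩ | ⟨h3, h4⟩
      · exact Fin.ext (hinj _ (by omega) _ (by omega) (Subtype.ext h3))
      · have h5 := hinj _ (by omega) _ (by omega) (Subtype.ext h3)
        have h6 := hinj _ (by omega) _ (by omega) (Subtype.ext h4)
        omega
    · exact absurd hij (hfs i hi).1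
    · exact absurd hij.symm (hfs j hj).1
    · exact Fin.ext (by omega)
  let c : E(G) → ℤ := Function.extend edge sgn 0
  have hc : ∀ i, c (edge i) = sgn i := fun i => hedge.extend_apply _ _ i
  have hc' : ∀ g, g ∉ Set.range edge → c g = 0 := fun g hg =>
    Function.extend_apply' _ _ _ fun ⟨i, hi⟩ => hg ⟨i, hi⟩
  refine ⟨c, ⟨n, fun i => v i, edge, fun i j hij => ?_, hedge, ?_, fun i => ?_⟩, ?_, fun g hg => ?_⟩
  · have hi2 := i.2
    have hj2 := j.2
    exact Fin.ext (hinj _ (by omega) _ (by omega) hij)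
  · ext g
    constructor
    · rintro ⟨i, rfl⟩
      rw [Function.mem_support, hc]
      rcases (harc i).sign with h1 | h1 <;> simp [h1]
    · intro hg
      by_contra h1
      exact hg (hc' g h1)
  · rw [hc]
    exact harc i
  · have : edge (Fin.last n) = e := by simp [edge]
    rw [← this, hc]
    simp [sgn]
  · by_cases hgr : g ∈ Set.range edge
    · obtain ⟨i, rfl⟩ := hgr
      by_cases hi : (i : ℕ) < n
      · rw [hc]
        have h1 := hfs i hi
        simp only [edge, sgn, hi, if_true]
        exact ⟨h1.2.1, h1.2.2.1⟩
      · exact absurd (by simp [edge, hi]) hg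
    · simp [hc' g hgr]

/-- The cut of the reachable set `W` need not be minimal, so `K` is the component of the tail of `e`
in the complement of `W`. Both `K` and its complement are connected, which makes the cut minimal,
and all its edges end in `W`, so none can be traversed from `W` into `K` by a step. -/
theorem exists_directedCocycle (hG : G.IsConnectedGraph) {P N : Set E(G)} {e : E(G)}
    (h : ¬ Relation.ReflTransGen (R.Step P N e) (R.head e) (R.tail e)) :
    ∃ d, R.IsDirectedCocycle d ∧ d e = 1 ∧
      ∀ f, f ≠ e → (d f = 1 → f ∉ N) ∧ (d f = -1 → f ∉ P) := by
  let W : Set V(G) := {v | Relation.ReflTransGen (R.Step P N e) (R.head e) v}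
  let K : Set V(G) := {v | Relation.ReflTransGen
    (fun x y : V(G) => (∃ f : E(G), G.IsLink f x y) ∧ x ∉ W ∧ y ∉ W) (R.tail e) v}
  have hKW : ∀ v ∈ K, v ∉ W := by
    intro v hv
    induction hv with
    | refl => exact h
    | tail _ hbc _ => exact hbc.2.2
  have hout : ∀ {f : E(G)} {u v : V(G)}, G.IsLink f u v → u ∈ K → v ∉ K → v ∈ W := by
    intro f u v hf hu hv
    by_contra hvW
    exact hv (Relation.ReflTransGen.tail hu ⟨⟨f, hf⟩, hKW u hu, hvW⟩)
  have htail : R.tail e ∈ K := Relation.ReflTransGen.refl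
  have hheadW : R.head e ∈ W := Relation.ReflTransGen.refl
  have hhead : R.head e ∉ K := fun h => hKW _ h hheadW
  have hcoc : G.IsCocycle (G.cut K) := by
    refine ⟨⟨⟨e, _, _, htail, hhead, R.isLink e⟩, K, rfl⟩, ?_⟩
    rintro _ ⟨⟨g, hg⟩, K', rfl⟩ hsub
    have hsame : ∀ {f : E(G)} {u v : V(G)}, G.IsLink f u v → (u ∈ K ↔ v ∈ K) →
        (u ∈ K' ↔ v ∈ K') := by
      intro f u v hf huv
      refine mem_iff_of_notMem_cut hf fun h' => ?_
      have := mem_iff_notMem_of_mem_cut hf (hsub h')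
      tauto
    have hK : ∀ v ∈ K, (v ∈ K' ↔ R.tail e ∈ K') := by
      intro v hv
      induction hv with
      | refl => rfl
      | @tail b c hb hbc ih =>
        rw [← ih]
        obtain ⟨f, hf⟩ := hbc.1
        exact (hsame hf ⟨fun _ => Relation.ReflTransGen.tail hb hbc, fun _ => hb⟩).symm
    have hW : ∀ v ∈ W, (v ∈ K' ↔ R.head e ∈ K') := by
      intro v hv
      induction hv with
      | refl => rfl
      | @tail b c hb hbc ih =>
        rw [← ih]
        obtain ⟨f, s, h1, h2, h3, h4⟩ := id hbc
        exact (hsame h4.isLink ⟨fun hbK => absurd hb (hKW _ hbK), fun hcK =>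
          absurd (Relation.ReflTransGen.tail hb hbc) (hKW _ hcK)⟩).symm
    -- Follow a walk in `G` from the head of `e`: whenever it leaves `K` it lands in `W`, where
    -- membership in `K'` is already known.
    have hKc : ∀ v, v ∉ K → (v ∈ K' ↔ R.head e ∈ K') := by
      intro v
      have hv := hG.2 (R.head e) v
      induction hv with
      | refl => exact fun _ => Iff.rfl
      | @tail b c _ hbc ih =>
        intro hcK
        obtain ⟨f, -, hf⟩ := hbc
        by_cases hbK : b ∈ K
        · exact hW c (hout hf hbK hcK)
        · rw [← ih hbK]
          exact (hsame hf (by tauto)).symm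
    have hdiff : ¬ (R.tail e ∈ K' ↔ R.head e ∈ K') := by
      obtain ⟨a, b, ha, hb, hab⟩ := id hg
      have := mem_iff_notMem_of_mem_cut hab (hsub hg)
      by_cases haK : a ∈ K
      · have h1 := hK a haK
        have h2 := hKc b (this.1 haK)
        tauto
      · have h1 := hKc a haK
        have h2 := hK b (by tauto)
        tauto
    rintro f ⟨u, v, hu, hv, huv⟩
    have h1 := hK u hu
    have h2 := hKc v hv
    by_contra hf
    have := mem_iff_of_notMem_cut huv hf
    tauto
  refine ⟨R.delta K, isDirectedCocycle_iff.2 ⟨K, hcoc, rfl⟩, by simp [delta, htail, hhead],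
    fun f hf => ⟨fun hd hfN => ?_, fun hd hfP => ?_⟩⟩
  · by_cases h1 : R.tail f ∈ K <;> by_cases h2 : R.head f ∈ K <;> simp [delta, h1, h2] at hd
    have h3 := hout (R.isLink f) h1 h2
    exact hKW _ h1 (Relation.ReflTransGen.tail h3
      ⟨f, -1, hf, by simp, fun _ => hfN, Or.inr ⟨rfl, rfl, rfl⟩⟩)
  · by_cases h1 : R.tail f ∈ K <;> by_cases h2 : R.head f ∈ K <;> simp [delta, h1, h2] at hd
    have h3 := hout (R.isLink f).symm h2 h1
    exact hKW _ h2 (Relation.ReflTransGen.tail h3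
      ⟨f, 1, hf, fun _ => hfP, by simp, Or.inl ⟨rfl, rfl, rfl⟩⟩)

variable (R) in
/-- The directed cycles and cocycles of a connected graph. -/
def digraphoid [Fintype E(G)] (hG : G.IsConnectedGraph) : Digraphoid E(G) where
  circ := {c | R.IsDirectedCycle c}
  cocirc := {d | R.IsDirectedCocycle d}
  circ_val _ hc := hc.val
  cocirc_val d hd := by
    obtain ⟨W, -, rfl⟩ := isDirectedCocycle_iff.1 hd
    exact delta_val W
  circ_ne _ hc := hc.nonzero
  cocirc_ne _ hd := hd.1.prop.1
  circ_neg _ hc := hc.neg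
  cocirc_neg d hd := by
    obtain ⟨W, hW, rfl⟩ := isDirectedCocycle_iff.1 hd
    refine isDirectedCocycle_iff.2 ⟨Wᶜ, ?_, (delta_compl W).symm⟩
    rwa [← support_delta (R := R), delta_compl, Function.support_neg, support_delta]
  orth c hc d hd := by
    obtain ⟨W, -, rfl⟩ := isDirectedCocycle_iff.1 hd
    exact hc.sum_mul_delta W
  painting P N e := by
    by_cases h : Relation.ReflTransGen (R.Step P N e) (R.head e) (R.tail e)
    · exact Or.inl (exists_directedCycle h)
    · exact Or.inr (exists_directedCocycle hG h)

end RefOrientation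

end Graph

/-! ### Translation between the graph and its digraphoid -/

namespace Digraphoid

/-- If two circuits with the same support agree at `e` but are distinct, a circuit conformal to
their difference has its support inside theirs and misses `e`, against minimality. -/
theorem eq_or_eq_neg_of_minimal {E : Type*} [Fintype E] {M : Digraphoid E} {c c' : E → ℤ}
    (hc : c ∈ M.circ) (hc' : c' ∈ M.circ) (hs : Function.support c' = Function.support c)
    (hmin : ∀ b ∈ M.circ, Function.support b ⊆ Function.support c →
      Function.support c ⊆ Function.support b) : c' = c ∨ c' = -c := by
  have key : ∀ {a : E → ℤ}, a ∈ M.circ → Function.support a = Function.support c →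
      ∀ {e}, c e ≠ 0 → a e = c e → a = c := by
    intro a ha hs e hce hae
    by_contra hne
    obtain ⟨f, hf⟩ := Function.ne_iff.1 hne
    have hx := M.flows.sub_mem (toReal_mem_flows ha) (toReal_mem_flows hc)
    have hxf : (toReal a - toReal c) f ≠ 0 := by
      simp only [Pi.sub_apply, toReal]
      exact sub_ne_zero.2 (by exact_mod_cast hf)
    obtain ⟨b, hb, -, hbf⟩ := exists_conformal hx hxf
    refine hmin b hb (fun g hg => ?_) hce ?_
    · by_contra hgc
      have hga : g ∉ Function.support a := hs ▸ hgc
      rw [Function.mem_support, not_not] at hgc hga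
      simpa [toReal, hgc, hga] using hbf g hg
    · by_contra hbe
      simpa [toReal, hae] using hbf e hbe
  obtain ⟨e, he⟩ := M.circ_ne c hc
  have he' : c' e ≠ 0 := by
    change e ∈ Function.support c'
    rw [hs]
    exact he
  have h : c' e = c e ∨ (-c') e = c e := by
    rcases M.circ_val c hc e with h1 | h1 | h1 <;> rcases M.circ_val c' hc' e with h2 | h2 | h2 <;>
      simp_all
  rcases h with h | h
  · exact Or.inl (key hc' hs he h)
  · right
    rw [← key (M.circ_neg _ hc') (by rwa [Function.support_neg]) he h, neg_neg]

end Digraphoid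

namespace Graph

variable {α β : Type*} {G : Graph α β}

namespace RefOrientation

variable {R : G.RefOrientation}

theorem IsDirectedCycle.isCycle {c : E(G) → ℤ} (h : R.IsDirectedCycle c) :
    G.IsCycle (Function.support c) := by
  obtain ⟨n, v, f, hv, hf, hs, harc⟩ := h
  exact ⟨n, v, f, hv, hf, hs, fun i => (harc i).isLink⟩

theorem IsDirectedCocycle.isCocycle {d : E(G) → ℤ} (h : R.IsDirectedCocycle d) :
    G.IsCocycle (Function.support d) :=
  h.1

variable [Fintype E(G)]

theorem IsDirectedCocycle.eq_or_eq_neg (hG : G.IsConnectedGraph) {d d' : E(G) → ℤ}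
    (h : R.IsDirectedCocycle d) (h' : R.IsDirectedCocycle d')
    (hs : Function.support d' = Function.support d) : d' = d ∨ d' = -d :=
  Digraphoid.eq_or_eq_neg_of_minimal (M := (R.digraphoid hG).dual) h h' hs fun _ hb hsub =>
    h.1.le_of_le (IsDirectedCocycle.isCocycle hb).prop hsub

/-- The signature serves only to give a direction to a cycle. -/
theorem isSpanningForest_iff (σ : R.CycleSignature) (hG : G.IsConnectedGraph) {S : Set E(G)} :
    G.IsSpanningForest S ↔ ∀ c ∈ (R.digraphoid hG).circ, ∃ f, f ∉ S ∧ c f ≠ 0 := by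
  constructor
  · intro h c hc
    have := h _ (IsDirectedCycle.isCycle hc)
    rw [Set.not_subset] at this
    obtain ⟨f, hf, hfS⟩ := this
    exact ⟨f, hfS, hf⟩
  · intro h C hC hCS
    obtain ⟨f, hf, hcf⟩ := h _ (σ.isDirectedCycle ⟨C, hC⟩)
    rw [← Function.mem_support, σ.support_dir] at hcf
    exact hf (hCS hcf)

theorem isConnectedSpanning_iff (hG : G.IsConnectedGraph) {S : Set E(G)} :
    G.IsConnectedSpanning S ↔ ∀ d ∈ (R.digraphoid hG).cocirc, ∃ f, f ∈ S ∧ d f ≠ 0 := by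
  constructor
  · intro h d hd
    obtain ⟨W, hW, rfl⟩ := isDirectedCocycle_iff.1 hd
    obtain ⟨e, u, v, hu, hv, -⟩ := hW.prop.1
    by_contra hcon
    push Not at hcon
    have hmem : ∀ x, Relation.ReflTransGen (fun x y : V(G) => ∃ e ∈ S, G.IsLink e x y) u x →
        x ∈ W := by
      intro x hx
      induction hx with
      | refl => exact hu
      | @tail b c _ hbc ih =>
        obtain ⟨f, hf, hl⟩ := hbc
        refine (mem_iff_of_notMem_cut hl fun h' => ?_).1 ih
        exact delta_ne_zero_iff.2 h' (hcon f hf)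
    exact hv (hmem v (h.2 u v))
  · intro h
    refine ⟨hG.1, fun u v => ?_⟩
    by_contra huv
    let W : Set V(G) :=
      {x | Relation.ReflTransGen (fun x y : V(G) => ∃ e ∈ S, G.IsLink e x y) u x}
    have hSW : ∀ f ∈ S, f ∉ G.cut W := by
      rintro f hf ⟨a, b, ha, hb, hab⟩
      exact hb (Relation.ReflTransGen.tail ha ⟨f, hf, hab⟩)
    obtain ⟨e, he⟩ : ∃ e, e ∈ G.cut W := by
      by_contra hcon
      push Not at hcon
      have : ∀ x, Relation.ReflTransGen
          (fun x y : V(G) => ∃ e ∈ (Set.univ : Set E(G)), G.IsLink e x y) u x → x ∈ W := by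
        intro x hx
        induction hx with
        | refl => exact Relation.ReflTransGen.refl
        | tail _ hbc ih =>
          obtain ⟨f, -, hl⟩ := hbc
          exact (mem_iff_of_notMem_cut hl (hcon f)).1 ih
      exact huv (this v (hG.2 u v))
    have heS : e ∉ S := fun h' => hSW e h' he
    -- The cut of `W` avoids `S` but may fail to be minimal. Painting gives a cocircuit missing `S`,
    -- or a circuit in `S ∪ {e}` that crosses the cut only at `e`, which orthogonality excludes.
    rcases (R.digraphoid hG).painting S S e with ⟨c, hc, h1, hcS⟩ | ⟨d, hd, h1, hdS⟩
    · have hsum := IsDirectedCycle.sum_mul_delta hc W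
      rw [Finset.sum_eq_single e, h1, one_mul] at hsum
      · exact delta_ne_zero_iff.2 he hsum
      · intro f _ hfe
        rcases (R.digraphoid hG).circ_val c hc f with h2 | h2 | h2
        · simp [h2]
        · have := hSW f ((hcS f hfe).1 h2)
          rw [← delta_ne_zero_iff (R := R), not_not] at this
          simp [this]
        · have := hSW f ((hcS f hfe).2 h2)
          rw [← delta_ne_zero_iff (R := R), not_not] at this
          simp [this]
      · simp
    · obtain ⟨f, hf, hdf⟩ := h d hd
      have hfe : f ≠ e := fun h' => heS (h' ▸ hf)
      rcases (R.digraphoid hG).cocirc_val d hd f with h2 | h2 | h2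
      · exact hdf h2
      · exact (hdS f hfe).1 h2 hf
      · exact (hdS f hfe).2 h2 hf

theorem isSpanningTree_iff (σ : R.CycleSignature) (hG : G.IsConnectedGraph) {T : Set E(G)} :
    G.IsSpanningTree T ↔ (R.digraphoid hG).IsBasis T := by
  rw [IsSpanningTree, isSpanningForest_iff σ hG, isConnectedSpanning_iff (R := R) hG]
  exact ⟨fun h => ⟨h.2, h.1⟩, fun h => ⟨h.2, h.1⟩⟩

theorem CycleSignature.exists_weight (σ : R.CycleSignature) (hσ : σ.Acyclic)
    (hG : G.IsConnectedGraph) : ∃ w, (R.digraphoid hG).Generic w ∧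
      (∀ C, 0 < Digraphoid.ip (σ.dir C) w) ∧
      ∀ O, σ.Compatible O ↔ (R.digraphoid hG).Compat w O := by
  refine Digraphoid.exists_weight σ.dir (fun c hc => ?_) hσ
  refine ⟨⟨_, IsDirectedCycle.isCycle hc⟩, ?_⟩
  exact IsDirectedCycle.eq_or_eq_neg (σ.isDirectedCycle _) hc
    (σ.support_dir ⟨_, IsDirectedCycle.isCycle hc⟩).ge

theorem CocycleSignature.exists_weight (τ : R.CocycleSignature) (hτ : τ.Acyclic)
    (hG : G.IsConnectedGraph) : ∃ w, (R.digraphoid hG).dual.Generic w ∧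
      (∀ D, 0 < Digraphoid.ip (τ.dir D) w) ∧
      ∀ O, τ.Compatible O ↔ (R.digraphoid hG).dual.Compat w O := by
  refine Digraphoid.exists_weight τ.dir (fun d hd => ?_) hτ
  refine ⟨⟨_, IsDirectedCocycle.isCocycle hd⟩, ?_⟩
  exact IsDirectedCocycle.eq_or_eq_neg hG (τ.isDirectedCocycle _) hd
    (τ.support_dir ⟨_, IsDirectedCocycle.isCocycle hd⟩).symm

theorem isGeometricImage {σ : R.CycleSignature} {τ : R.CocycleSignature}
    {hG : G.IsConnectedGraph} {w wd : E(G) → ℝ} (hw : (R.digraphoid hG).Generic w)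
    (hwd : (R.digraphoid hG).dual.Generic wd) (hσ : ∀ C, 0 < Digraphoid.ip (σ.dir C) w)
    (hτ : ∀ D, 0 < Digraphoid.ip (τ.dir D) wd) {T : Set E(G)} {O : G.Orientation}
    {x z : E(G) → ℝ} (h : (R.digraphoid hG).IsGeo w wd T O x z) : IsGeometricImage σ τ T O := by
  have hT := h.isBasis hw hwd
  have hsub : ∀ {S : Set E(G)} {e : E(G)} {c : E(G) → ℤ}, (∀ f, f ≠ e → c f ≠ 0 → f ∈ S) →
      Function.support c ⊆ S ∪ {e} := by
    intro S e c hc f hf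
    by_cases hfe : f = e
    · exact Or.inr hfe
    · exact Or.inl (hc f hfe hf)
  refine ⟨fun e he => ?_, fun e he => ?_⟩
  · obtain ⟨c, hc, hce, hcT⟩ := hT.exists_fundamental he
    have hcyc : G.IsCycle (Function.support c) := IsDirectedCycle.isCycle hc
    refine ⟨⟨_, hcyc⟩, ⟨⟨hcyc, hsub hcT⟩, fun C' hC' hC'T => ?_⟩, ?_⟩
    · refine (σ.support_dir ⟨C', hC'⟩).symm.trans ?_
      refine hT.support_unique (e := e) (σ.isDirectedCycle _) hc ?_ (hsub hcT)
      rwa [σ.support_dir]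
    · refine h.eq_sign he (σ.isDirectedCycle _) (fun f hfe hf => ?_) (hσ _)
      rw [← Function.mem_support, σ.support_dir] at hf
      exact hcT f hfe hf
  · obtain ⟨d, hd, hde, hdT⟩ := hT.compl.exists_fundamental (e := e) (not_not.2 he)
    have hcoc : G.IsCocycle (Function.support d) := IsDirectedCocycle.isCocycle hd
    refine ⟨⟨_, hcoc⟩, ⟨⟨hcoc, hsub hdT⟩, fun D' hD' hD'T => ?_⟩, ?_⟩
    · refine (τ.support_dir ⟨D', hD'⟩).symm.trans ?_
      refine hT.compl.support_unique (e := e) (τ.isDirectedCocycle _) hd ?_ (hsub hdT)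
      rwa [τ.support_dir]
    · refine h.dual.eq_sign (e := e) (not_not.2 he) (τ.isDirectedCocycle _)
        (fun f hfe hf => ?_) (hτ _)
      rw [← Function.mem_support, τ.support_dir] at hf
      exact hdT f hfe hf

/-- The families live in `O'`; on their edges `O` is the opposite of `O'`, so the restrictions of
`O` are negatives of sums of directed cycles or cocycles. -/
theorem IsReversal.parts (hG : G.IsConnectedGraph) {O O' : G.Orientation}
    {𝒞 𝒟 : Set (E(G) → ℤ)} (h : R.IsReversal O' 𝒞 𝒟 O) :
    Digraphoid.part O (edgesOf 𝒞) ∈ (R.digraphoid hG).flows ∧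
      Digraphoid.part O (edgesOf 𝒟) ∈ (R.digraphoid hG).dual.flows ∧
      O' = Digraphoid.flip O (edgesOf 𝒞 ∪ edgesOf 𝒟) := by
  refine ⟨?_, ?_, ?_⟩
  · rw [Digraphoid.part_eq_neg fun e he => h.reversed e (Or.inl he)]
    exact Submodule.neg_mem _ (Digraphoid.part_iUnion_mem h.cycles h.disjoint_cycles)
  · rw [Digraphoid.part_eq_neg fun e he => h.reversed e (Or.inr he)]
    exact Submodule.neg_mem _ (Digraphoid.part_iUnion_mem (M := (R.digraphoid hG).dual)
      h.cocycles h.disjoint_cocycles)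
  · funext e
    by_cases he : e ∈ edgesOf 𝒞 ∪ edgesOf 𝒟
    · rw [Digraphoid.flip_of_mem he, h.reversed e he, neg_neg]
    · rw [Digraphoid.flip_of_notMem he, h.unchanged e he]

theorem exists_isReversal (hG : G.IsConnectedGraph) {O : G.Orientation} {A B : Set E(G)}
    (hA : Digraphoid.part O A ∈ (R.digraphoid hG).flows)
    (hB : Digraphoid.part O B ∈ (R.digraphoid hG).dual.flows) :
    ∃ 𝒞 𝒟, R.IsReversal (Digraphoid.flip O (A ∪ B)) 𝒞 𝒟 O := by
  have hA' : Digraphoid.part (Digraphoid.flip O (A ∪ B)) A ∈ (R.digraphoid hG).flows := by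
    rw [Digraphoid.part_eq_neg fun e he => Digraphoid.flip_of_mem (Set.mem_union_left B he)]
    exact Submodule.neg_mem _ hA
  have hB' : Digraphoid.part (Digraphoid.flip O (A ∪ B)) B ∈ (R.digraphoid hG).dual.flows := by
    rw [Digraphoid.part_eq_neg fun e he => Digraphoid.flip_of_mem (Set.mem_union_right A he)]
    exact Submodule.neg_mem _ hB
  obtain ⟨𝒞, h1, h2, h3⟩ := Digraphoid.exists_family hA'
  obtain ⟨𝒟, h4, h5, h6⟩ := Digraphoid.exists_family hB'
  have h3' : edgesOf 𝒞 = A := h3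
  have h6' : edgesOf 𝒟 = B := h6
  refine ⟨𝒞, 𝒟, h1, h4, h2, h5, fun c hc d hd => Set.disjoint_left.2 fun f hf hf' => ?_,
    fun e he => ?_, fun e he => ?_⟩
  · exact Digraphoid.notMem_of_part_mem hA hB (h3 ▸ Set.mem_biUnion hc hf)
      (h6 ▸ Set.mem_biUnion hd hf')
  · rw [h3', h6'] at he
    rw [Digraphoid.flip_of_mem he, neg_neg]
  · rw [h3', h6'] at he
    rw [Digraphoid.flip_of_notMem he]

end RefOrientation

end Graph

/-! ### Assembly of the theorem -/

theorem theorem1p2 {α β : Type*} (G : Graph α β) [Finite V(G)] [Finite E(G)]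
    (hG : G.IsConnectedGraph) (R : G.RefOrientation)
    (σ : R.CycleSignature) (τ : R.CocycleSignature) (hσ : σ.Acyclic) (hτ : τ.Acyclic) :
    ∃ (g : {T : Set E(G) // G.IsSpanningTree T} ≃
          {O : G.Orientation // σ.Compatible O ∧ τ.Compatible O})
      (φ : G.Orientation → Set E(G)),
      -- `g` is the geometric bijection
      (∀ T, Graph.RefOrientation.IsGeometricImage σ τ T.1 (g T).1) ∧
      -- every orientation comes from a unique compatible orientation by disjoint reversals
      (∀ O, ∃! Ocp : {O : G.Orientation // σ.Compatible O ∧ τ.Compatible O},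
        ∃ 𝒞 𝒟, R.IsReversal Ocp.1 𝒞 𝒟 O) ∧
      -- the value of `φ`, whichever cycles and cocycles are used
      (∀ (Ocp : {O : G.Orientation // σ.Compatible O ∧ τ.Compatible O}) 𝒞 𝒟 O,
        R.IsReversal Ocp.1 𝒞 𝒟 O →
          φ O = ((g.symm Ocp).1 ∪ Graph.RefOrientation.edgesOf 𝒞) \
            Graph.RefOrientation.edgesOf 𝒟) ∧
      -- (1)
      Function.Bijective φ ∧
      -- (2)
      (Set.BijOn φ {O | σ.Compatible O} {S | G.IsSpanningForest S} ∧
        ∀ (Ocp : {O : G.Orientation // σ.Compatible O ∧ τ.Compatible O}) 𝒞 𝒟 O,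
          R.IsReversal Ocp.1 𝒞 𝒟 O → σ.Compatible O →
            φ O = (g.symm Ocp).1 \ Graph.RefOrientation.edgesOf 𝒟) ∧
      -- (3)
      (Set.BijOn φ {O | τ.Compatible O} {S | G.IsConnectedSpanning S} ∧
        ∀ (Ocp : {O : G.Orientation // σ.Compatible O ∧ τ.Compatible O}) 𝒞 𝒟 O,
          R.IsReversal Ocp.1 𝒞 𝒟 O → τ.Compatible O →
            φ O = (g.symm Ocp).1 ∪ Graph.RefOrientation.edgesOf 𝒞) := by
  classical
  have := Fintype.ofFinite E(G)
  let M := R.digraphoid hG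
  obtain ⟨w, hw, hwpos, hwc⟩ := σ.exists_weight hσ hG
  obtain ⟨wd, hwd, hwdpos, hwdc⟩ := τ.exists_weight hτ hG
  choose O₀ x₀ z₀ hgeo using fun T : {T : Set E(G) // G.IsSpanningTree T} =>
    ((Graph.RefOrientation.isSpanningTree_iff σ hG).1 T.2).exists_isGeo hw hwd
  have hbij : Function.Bijective (fun T => (⟨O₀ T, (hwc _).2 ((hgeo T).compat hw),
      (hwdc _).2 ((hgeo T).dual.compat hwd)⟩ :
        {O : G.Orientation // σ.Compatible O ∧ τ.Compatible O})) := by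
    constructor
    · intro T T' h
      have h1 : O₀ T = O₀ T' := congrArg Subtype.val h
      exact Subtype.ext ((hgeo T).tree_unique (h1 ▸ hgeo T'))
    · rintro ⟨O, hO, hO'⟩
      obtain ⟨T, x, z, h⟩ := Digraphoid.exists_isGeo hw hwd ((hwc O).1 hO) ((hwdc O).1 hO')
      refine ⟨⟨T, (Graph.RefOrientation.isSpanningTree_iff σ hG).2 (h.isBasis hw hwd)⟩,
        Subtype.ext ?_⟩
      exact (hgeo _).orientation_unique h hw hwd
  let g := Equiv.ofBijective _ hbij
  have hg : ∀ Ocp, ∃ x z, M.IsGeo w wd (g.symm Ocp).1 Ocp.1 x z := by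
    intro Ocp
    have h1 := hgeo (g.symm Ocp)
    have h2 : O₀ (g.symm Ocp) = Ocp.1 := congrArg Subtype.val (g.apply_symm_apply Ocp)
    rw [h2] at h1
    exact ⟨_, _, h1⟩
  choose A B hA hB hAB hAB' using fun O : G.Orientation =>
    Digraphoid.exists_compat_flip (M := M) hw hwd O
  let cp : G.Orientation → {O : G.Orientation // σ.Compatible O ∧ τ.Compatible O} := fun O =>
    ⟨Digraphoid.flip O (A O ∪ B O), (hwc _).2 (hAB O), (hwdc _).2 (hAB' O)⟩
  let φ : G.Orientation → Set E(G) := fun O => ((g.symm (cp O)).1 ∪ A O) \ B O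
  have hrev : ∀ (Ocp : {O : G.Orientation // σ.Compatible O ∧ τ.Compatible O}) 𝒞 𝒟 O,
      R.IsReversal Ocp.1 𝒞 𝒟 O → Graph.RefOrientation.edgesOf 𝒞 = A O ∧
        Graph.RefOrientation.edgesOf 𝒟 = B O ∧ Ocp = cp O := by
    rintro ⟨O', hO, hO'⟩ 𝒞 𝒟 O h
    obtain ⟨h1, h2, h3⟩ := h.parts hG
    replace h3 : O' = _ := h3
    rw [hwc, h3] at hO
    rw [hwdc, h3] at hO'
    have e1 : Graph.RefOrientation.edgesOf 𝒞 = A O :=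
      Digraphoid.eq_of_compat_flip h1 h2 (hA O) (hB O) hO (hAB O)
    have e2 : Graph.RefOrientation.edgesOf 𝒟 = B O := by
      refine Digraphoid.eq_of_compat_flip (M := M.dual) h2 h1 (hB O) (hA O) (w := wd) ?_ ?_
      · rwa [Set.union_comm]
      · rw [Set.union_comm]
        exact hAB' O
    refine ⟨e1, e2, Subtype.ext ?_⟩
    rw [e1, e2] at h3
    exact h3
  -- The construction of φ is self-dual under complementation because `A O` and `B O` are disjoint;
  -- this turns the forest criterion into the connectivity criterion.
  have hcompl : ∀ O, ((g.symm (cp O)).1ᶜ ∪ B O) \ A O = (φ O)ᶜ := by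
    intro O
    ext e
    have h1 := fun h : e ∈ A O => Digraphoid.notMem_of_part_mem (hA O) (hB O) h
    simp only [φ, Set.mem_sdiff, Set.mem_union, Set.mem_compl_iff]
    tauto
  have hbasis : ∀ Ocp, M.IsBasis (g.symm Ocp).1 := fun Ocp =>
    (Graph.RefOrientation.isSpanningTree_iff σ hG).1 (g.symm Ocp).2
  have hφinj : Function.Injective φ := by
    intro O O' h
    obtain ⟨x, z, hx⟩ := hg (cp O)
    obtain ⟨x', z', hx'⟩ := hg (cp O')
    exact Digraphoid.orientation_eq_of_set_eq hw hwd hx (hA O) (hB O) hx' (hA O') (hB O') h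
  have hφ : Function.Bijective φ := by
    have := Fintype.ofFinite (Set E(G))
    -- Orientations and edge sets both number 2 to the power of the number of edges.
    refine (Fintype.bijective_iff_injective_and_card φ).2 ⟨hφinj, ?_⟩
    rw [← Nat.card_eq_fintype_card, ← Nat.card_eq_fintype_card]
    simp [Set]
  have hσA : ∀ O, σ.Compatible O ↔ A O = ∅ := fun O => by
    rw [hwc]
    exact Digraphoid.compat_iff_eq_empty (hA O) (hB O) (hAB O)
  have hτB : ∀ O, τ.Compatible O ↔ B O = ∅ := fun O => by
    rw [hwdc]
    refine Digraphoid.compat_iff_eq_empty (M := M.dual) (hB O) (hA O) ?_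
    rw [Set.union_comm]
    exact hAB' O
  have hforest : ∀ O, G.IsSpanningForest (φ O) ↔ σ.Compatible O := fun O => by
    rw [hσA, Graph.RefOrientation.isSpanningForest_iff σ hG]
    exact Digraphoid.no_circ_iff_eq_empty (hA O) (hB O) (hbasis _)
  have hconn : ∀ O, G.IsConnectedSpanning (φ O) ↔ τ.Compatible O := fun O => by
    rw [hτB, Graph.RefOrientation.isConnectedSpanning_iff (R := R) hG,
      ← Digraphoid.no_circ_iff_eq_empty (M := M.dual) (hB O) (hA O) (hbasis (cp O)).compl, hcompl]
    simp only [Set.mem_compl_iff, not_not]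
    rfl
  have hval : ∀ (Ocp : {O : G.Orientation // σ.Compatible O ∧ τ.Compatible O}) 𝒞 𝒟 O,
      R.IsReversal Ocp.1 𝒞 𝒟 O → φ O = ((g.symm Ocp).1 ∪ Graph.RefOrientation.edgesOf 𝒞) \
        Graph.RefOrientation.edgesOf 𝒟 := by
    intro Ocp 𝒞 𝒟 O h
    obtain ⟨h1, h2, rfl⟩ := hrev Ocp 𝒞 𝒟 O h
    rw [h1, h2]
  refine ⟨g, φ, fun T => Graph.RefOrientation.isGeometricImage hw hwd hwpos hwdpos (hgeo T),
    fun O => ⟨cp O, Graph.RefOrientation.exists_isReversal hG (hA O) (hB O), ?_⟩, hval, hφ,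
    ⟨⟨fun O hO => (hforest O).2 hO, hφinj.injOn, fun S hS => ?_⟩, ?_⟩,
    ⟨⟨fun O hO => (hconn O).2 hO, hφinj.injOn, fun S hS => ?_⟩, ?_⟩⟩
  · rintro Ocp ⟨𝒞, 𝒟, h⟩
    exact (hrev Ocp 𝒞 𝒟 O h).2.2
  · obtain ⟨O, rfl⟩ := hφ.2 S
    exact ⟨O, (hforest O).1 hS, rfl⟩
  · intro Ocp 𝒞 𝒟 O h hO
    rw [hval Ocp 𝒞 𝒟 O h, (hrev Ocp 𝒞 𝒟 O h).1, (hσA O).1 hO, Set.union_empty]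
  · obtain ⟨O, rfl⟩ := hφ.2 S
    exact ⟨O, (hconn O).1 hS, rfl⟩
  · intro Ocp 𝒞 𝒟 O h hO
    rw [hval Ocp 𝒞 𝒟 O h, (hrev Ocp 𝒞 𝒟 O h).2.1, (hτB O).1 hO, Set.sdiff_empty]
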